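/- Let $n\ge 0$ and let $B$ be a closed (i.e. compact, without boundary, not necessarily connected), oriented smooth manifold of dimension $2n$. For a smooth principal $S^1$-bundle $\pi\colon M\to B$ write $\partial_\theta$ for the vector field on $M$ generating the $S^1$-action, and orient $M$ so that $(\partial_\theta,v_1,\dots,v_{2n})$ is a positive basis of $T_xM$ whenever $(d\pi(v_1),\dots,d\pi(v_{2n}))$ is a positive basis of $T_{\pi(x)}B$. An $S^1$-invariant contact structure on $M$ is a hyperplane field $\xi\subset TM$ that is preserved by the $S^1$-action and that can be written as $\xi=\ker\alpha$ for a smooth $1$-form $\alpha$ on $M$ such that $\alpha\wedge(d\alpha)^n$ is a positive volume form. Its dividing set is $$\Gamma=\{\,b\in B : \partial_\theta\in\xi \text{ at the points of } \pi^{-1}(b)\,\},$$ i.e. the zero set of the function $u=\alpha(\partial_\theta)$, viewed as a subset of $B$. Let $\Gamma\subset B$. If the trivial $S^1$-bundle $B\times S^1\to B$ admits an $S^1$-invariant contact structure with dividing set $\Gamma$, then every principal $S^1$-bundle over $B$ admits an $S^1$-invariant contact structure with the same dividing set $\Gamma$. -/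

import Mathlib

open scoped Manifold ContDiff Topology
open Bundle

noncomputable section

namespace CircleBundleContact

/-! ### Orientations -/

/-- An orientation of the `m`-manifold `B`: an orientation of every tangent space which is locally
constant when the tangent spaces near `x₀` are identified by means of the chart at `x₀`. -/
structure ManifoldOrientation (m : ℕ) (B : Type*) [TopologicalSpace B]
    [ChartedSpace (EuclideanSpace ℝ (Fin m)) B] [IsManifold (𝓡 m) ∞ B] where
  /-- the orientation of the tangent space at `x` -/
  orient : ∀ x : B, Orientation ℝ (TangentSpace (𝓡 m) x) (Fin m)
  locally_constant : ∀ x₀ : B, ∀ᶠ x in 𝓝 x₀,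
    ∀ (hx₀ : x₀ ∈ (trivializationAt (EuclideanSpace ℝ (Fin m)) (TangentSpace (𝓡 m)) x₀).baseSet)
      (hx : x ∈ (trivializationAt (EuclideanSpace ℝ (Fin m)) (TangentSpace (𝓡 m)) x₀).baseSet),
      Orientation.map (Fin m)
        ((trivializationAt (EuclideanSpace ℝ (Fin m)) (TangentSpace (𝓡 m)) x₀).continuousLinearEquivAt
          ℝ x hx).toLinearEquiv (orient x) =
      Orientation.map (Fin m)
        ((trivializationAt (EuclideanSpace ℝ (Fin m)) (TangentSpace (𝓡 m)) x₀).continuousLinearEquivAt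
          ℝ x₀ hx₀).toLinearEquiv (orient x₀)

/-! ### Differential forms -/

section Forms

variable {E : Type*} [NormedAddCommGroup E] [NormedSpace ℝ E] {H : Type*} [TopologicalSpace H]
  (I : ModelWithCorners ℝ E H) (M : Type*) [TopologicalSpace M] [ChartedSpace H M]

/-- A smooth 1-form: a smooth section of the cotangent bundle. -/
structure OneForm [IsManifold I ∞ M] where
  /-- the value of the form at a point -/
  toFun : ∀ x : M, TangentSpace I x →L[ℝ] ℝ
  smooth : ContMDiff I (I.prod 𝓘(ℝ, E →L[ℝ] ℝ)) ∞
    (fun x ↦ TotalSpace.mk' (E →L[ℝ] ℝ) (E := fun x : M ↦ TangentSpace I x →L[ℝ] ℝ) x (toFun x))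

variable {I M}

/-- The local representative of the 1-form `α` in the chart at `x₀`, i.e. its pullback under the
inverse of this chart. -/
def OneForm.localRep [IsManifold I ∞ M] (α : OneForm I M) (x₀ : M) (y : E) : E →L[ℝ] ℝ :=
  (α.toFun ((extChartAt I x₀).symm y)).comp
    (mfderiv 𝓘(ℝ, E) I (extChartAt I x₀).symm y : E →L[ℝ] _)

/-- The exterior derivative of the 1-form `α` (on a manifold without boundary), computed at `x₀` in
the chart at `x₀`: if `α = ∑ aⱼ dyⱼ` then `dα = ∑ daⱼ ∧ dyⱼ`. A tangent vector at `x₀` *is* in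
Mathlib the vector of its components in the chart at `x₀`, so no conversion is needed. -/
def OneForm.extDeriv [IsManifold I ∞ M] (α : OneForm I M) (x₀ : M)
    (v w : TangentSpace I x₀) : ℝ :=
  let D : E →L[ℝ] E →L[ℝ] ℝ := fderiv ℝ (α.localRep x₀) (extChartAt I x₀ x₀)
  D v w - D w v

/-- The value of `a ∧ bⁿ` on `2n+1` vectors, for a linear form `a` and an alternating bilinear
form `b`, with `(a ∧ a')(v, w) = a(v) a'(w) - a(w) a'(v)` as normalisation of the wedge product. -/
def wedgePow (n : ℕ) {V : Type*} (a : V → ℝ) (b : V → V → ℝ) (v : Fin (2 * n + 1) → V) : ℝ :=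
  (1 / 2 ^ n) * ∑ σ : Equiv.Perm (Fin (2 * n + 1)), ((Equiv.Perm.sign σ : ℤ) : ℝ) *
    (a (v (σ 0)) *
      ∏ i : Fin n, b (v (σ ⟨2 * (i : ℕ) + 1, by omega⟩)) (v (σ ⟨2 * (i : ℕ) + 2, by omega⟩)))

/-- The value of `α ∧ (dα)ⁿ` at the point `x`. -/
def OneForm.contactVolume [IsManifold I ∞ M] (α : OneForm I M) (n : ℕ) (x : M)
    (v : Fin (2 * n + 1) → TangentSpace I x) : ℝ :=
  wedgePow n (fun w ↦ α.toFun x w) (fun w w' ↦ α.extDeriv x w w') v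

end Forms

/-! ### Principal circle bundles -/

/-- A smooth principal `S¹`-bundle with total space `M` and base `B`: a smooth action of the circle
on `M` and a smooth map `proj : M → B` that is locally, over open sets covering `B`, equivariantly
diffeomorphic to the projection of a product with the circle. -/
structure PrincipalCircleBundle {EB : Type*} [NormedAddCommGroup EB] [NormedSpace ℝ EB]
    {HB : Type*} [TopologicalSpace HB] (IB : ModelWithCorners ℝ EB HB)
    (B : Type*) [TopologicalSpace B] [ChartedSpace HB B]
    {E : Type*} [NormedAddCommGroup E] [NormedSpace ℝ E]
    {H : Type*} [TopologicalSpace H] (I : ModelWithCorners ℝ E H)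
    (M : Type*) [TopologicalSpace M] [ChartedSpace H M] where
  /-- the action of the circle -/
  act : Circle → M → M
  /-- the bundle projection -/
  proj : M → B
  one_act : ∀ x, act 1 x = x
  mul_act : ∀ z w x, act (z * w) x = act z (act w x)
  smooth_act : ContMDiff ((𝓡 1).prod I) I ∞ (fun p : Circle × M ↦ act p.1 p.2)
  smooth_proj : ContMDiff I IB ∞ proj
  proj_act : ∀ z x, proj (act z x) = proj x
  exists_trivialization : ∀ b : B, ∃ e : Trivialization Circle proj, b ∈ e.baseSet ∧
    ContMDiffOn I (IB.prod (𝓡 1)) ∞ e e.source ∧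
    ContMDiffOn (IB.prod (𝓡 1)) I ∞ e.toOpenPartialHomeomorph.symm e.target ∧
    ∀ z, ∀ x ∈ e.source, (e (act z x)).2 = z * (e x).2

/-- The trivial principal `S¹`-bundle `B × S¹ → B`. -/
def trivialCircleBundle {EB : Type*} [NormedAddCommGroup EB] [NormedSpace ℝ EB]
    {HB : Type*} [TopologicalSpace HB] (IB : ModelWithCorners ℝ EB HB)
    (B : Type*) [TopologicalSpace B] [ChartedSpace HB B] :
    PrincipalCircleBundle IB B (IB.prod (𝓡 1)) (B × Circle) where
  act z p := (p.1, z * p.2)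
  proj := Prod.fst
  one_act p := by simp
  mul_act z w p := by simp [mul_assoc]
  smooth_act := by
    have h1 : ContMDiff ((𝓡 1).prod (IB.prod (𝓡 1))) (𝓡 1) ∞
        (fun p : Circle × (B × Circle) ↦ p.1 * p.2.2) :=
      contMDiff_fst.mul (contMDiff_snd.comp contMDiff_snd)
    exact (contMDiff_fst.comp contMDiff_snd).prodMk h1
  smooth_proj := contMDiff_fst
  proj_act _ _ := rfl
  exists_trivialization b :=
    ⟨{ toOpenPartialHomeomorph := OpenPartialHomeomorph.refl (B × Circle)
       baseSet := Set.univ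
       open_baseSet := isOpen_univ
       source_eq := by simp
       target_eq := by simp
       proj_toFun := by intro p _; rfl },
      Set.mem_univ b, contMDiffOn_id, contMDiffOn_id, fun _ _ _ ↦ rfl⟩

/-! ### Invariant contact structures -/

section Contact

variable {n : ℕ} {B : Type*} [TopologicalSpace B]
  [ChartedSpace (EuclideanSpace ℝ (Fin (2 * n))) B] [IsManifold (𝓡 (2 * n)) ∞ B]
  {E : Type*} [NormedAddCommGroup E] [NormedSpace ℝ E]
  {H : Type*} [TopologicalSpace H] {I : ModelWithCorners ℝ E H}
  {M : Type*} [TopologicalSpace M] [ChartedSpace H M] [IsManifold I ∞ M]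

/-- The vector field `∂_θ` generating the circle action: its value at `x` is the velocity at `t = 0`
of the curve `t ↦ e^{it} · x`. -/
def PrincipalCircleBundle.generator (P : PrincipalCircleBundle (𝓡 (2 * n)) B I M) (x : M) :
    TangentSpace I x :=
  (mfderiv 𝓘(ℝ, ℝ) I (fun t : ℝ ↦ P.act (Circle.exp t) x) 0 : ℝ →L[ℝ] E) (1 : ℝ)

/-- `α ∧ (dα)ⁿ` is a positive volume form on the total space `M`, where `M` carries the orientation
for which `(∂_θ, v₁, …, v₂ₙ)` is positive when `v₁, …, v₂ₙ` project to a positively oriented basis of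
the tangent space of `B`. Here `η` runs over the volume forms on the tangent space of `B` which
represent its orientation, and `v₁, …, v₂ₙ` project to a basis just when `η` does not vanish
on their images. -/
def IsPositiveContactForm (P : PrincipalCircleBundle (𝓡 (2 * n)) B I M)
    (o : ManifoldOrientation (2 * n) B) (α : OneForm I M) : Prop :=
  ∀ (x : M) (η : TangentSpace (𝓡 (2 * n)) (P.proj x) [⋀^Fin (2 * n)]→ₗ[ℝ] ℝ) (hη : η ≠ 0),
    rayOfNeZero ℝ η hη = o.orient (P.proj x) →
    ∀ v : Fin (2 * n) → TangentSpace I x,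
      η (fun i ↦ mfderiv I (𝓡 (2 * n)) P.proj x (v i)) ≠ 0 →
      0 < η (fun i ↦ mfderiv I (𝓡 (2 * n)) P.proj x (v i)) *
        α.contactVolume n x (Fin.cons (P.generator x) v)

/-- An `S¹`-invariant (coorientable, positive) contact structure on the total space of a principal
`S¹`-bundle over an oriented `2n`-manifold: a hyperplane field, invariant under the differential of
the action of every element of the circle, which is the kernel of a positive contact form. -/
structure InvariantContactStructure (P : PrincipalCircleBundle (𝓡 (2 * n)) B I M)
    (o : ManifoldOrientation (2 * n) B) where
  /-- the contact hyperplanes -/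
  plane : ∀ x : M, Submodule ℝ (TangentSpace I x)
  exists_form : ∃ α : OneForm I M, IsPositiveContactForm P o α ∧
    ∀ x, plane x = LinearMap.ker (α.toFun x : TangentSpace I x →ₗ[ℝ] ℝ)
  invariant : ∀ (z : Circle) (x : M),
    (plane x).map (mfderiv I I (P.act z) x : TangentSpace I x →ₗ[ℝ] TangentSpace I (P.act z x)) =
      plane (P.act z x)

/-- The dividing set of `B` induced by an invariant contact structure: the set of points over which
`∂_θ` is tangent to the contact hyperplanes. If the contact structure is the kernel of `α`, these
are the points over which the function `u = α(∂_θ)` vanishes. -/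
def InvariantContactStructure.dividingSet {P : PrincipalCircleBundle (𝓡 (2 * n)) B I M}
    {o : ManifoldOrientation (2 * n) B} (ξ : InvariantContactStructure P o) : Set B :=
  {b | ∃ x : M, P.proj x = b ∧ P.generator x ∈ ξ.plane x}

end Contact

end CircleBundleContact

end

noncomputable section

namespace CircleBundleContact

/-! ### Algebra of the form `a ∧ bⁿ` -/

section WedgePow

variable {V : Type*} [AddCommGroup V] [Module ℝ V]

lemma prod_eq_add_of_eq_off {n : ℕ} {f g h : Fin n → ℝ} (k : Fin n)
    (hg : ∀ i, i ≠ k → g i = f i) (hh : ∀ i, i ≠ k → h i = f i) (hk : f k = g k + h k) :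
    ∏ i, f i = ∏ i, g i + ∏ i, h i := by
  classical
  rw [Fintype.prod_eq_mul_prod_compl k f, Fintype.prod_eq_mul_prod_compl k g,
    Fintype.prod_eq_mul_prod_compl k h, hk, add_mul]
  congr 2 <;> refine Finset.prod_congr rfl fun i hi ↦ ?_
  · exact (hg i (by simpa using hi)).symm
  · exact (hh i (by simpa using hi)).symm

lemma prod_eq_mul_of_eq_off {n : ℕ} {f g : Fin n → ℝ} (c : ℝ) (k : Fin n)
    (hg : ∀ i, i ≠ k → g i = f i) (hk : f k = c * g k) :
    ∏ i, f i = c * ∏ i, g i := by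
  classical
  rw [Fintype.prod_eq_mul_prod_compl k f, Fintype.prod_eq_mul_prod_compl k g, hk, mul_assoc]
  congr 2
  exact Finset.prod_congr rfl fun i hi ↦ (hg i (by simpa using hi)).symm

lemma fin_two_mul_add_one_cases {n : ℕ} (j : Fin (2 * n + 1)) :
    j = 0 ∨ (∃ k : Fin n, j = ⟨2 * (k : ℕ) + 1, by omega⟩) ∨
      ∃ k : Fin n, j = ⟨2 * (k : ℕ) + 2, by omega⟩ := by
  obtain ⟨j, hj⟩ := j
  rcases Nat.eq_zero_or_pos j with rfl | h
  · exact Or.inl rfl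
  · rcases Nat.even_or_odd' j with ⟨m, rfl | rfl⟩
    · exact Or.inr (Or.inr ⟨⟨m - 1, by omega⟩, by ext; simp; omega⟩)
    · exact Or.inr (Or.inl ⟨⟨m, by omega⟩, rfl⟩)

/-- The multilinear map `v ↦ a(v₀) b(v₁, v₂) ⋯ b(v₂ₙ₋₁, v₂ₙ)`. -/
def wedgeMultilinear (n : ℕ) (a : V →ₗ[ℝ] ℝ) (b : V →ₗ[ℝ] V →ₗ[ℝ] ℝ) :
    MultilinearMap ℝ (fun _ : Fin (2 * n + 1) ↦ V) ℝ :=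
  MultilinearMap.mk'
    (fun v ↦ a (v 0) * ∏ i : Fin n, b (v ⟨2 * (i : ℕ) + 1, by omega⟩) (v ⟨2 * (i : ℕ) + 2, by omega⟩))
    (by
      intro v j x y
      rcases fin_two_mul_add_one_cases j with rfl | ⟨k, rfl⟩ | ⟨k, rfl⟩
      · simp [add_mul, Fin.ext_iff]
      all_goals
        simp only [Function.update_apply, Fin.ext_iff, Fin.val_zero]
        rw [if_neg (by omega), if_neg (by omega), if_neg (by omega), ← mul_add]
        congr 1
        refine prod_eq_add_of_eq_off k (fun i hi ↦ ?_) (fun i hi ↦ ?_) ?_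
        · have : (i : ℕ) ≠ k := fun h ↦ hi (Fin.ext h)
          simp [this, show (2 * (i : ℕ) + 2 ≠ 2 * k + 1) by omega,
            show (2 * (i : ℕ) ≠ 2 * k + 1) by omega]
        · have : (i : ℕ) ≠ k := fun h ↦ hi (Fin.ext h)
          simp [this, show (2 * (i : ℕ) + 2 ≠ 2 * k + 1) by omega,
            show (2 * (i : ℕ) ≠ 2 * k + 1) by omega]
        · simp)
    (by
      intro v j c x
      rcases fin_two_mul_add_one_cases j with rfl | ⟨k, rfl⟩ | ⟨k, rfl⟩
      · simp [mul_assoc, Fin.ext_iff]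
      all_goals
        simp only [Function.update_apply, Fin.ext_iff, Fin.val_zero]
        rw [if_neg (by omega), if_neg (by omega), smul_eq_mul, mul_left_comm]
        congr 1
        refine prod_eq_mul_of_eq_off c k (fun i hi ↦ ?_) ?_
        · have : (i : ℕ) ≠ k := fun h ↦ hi (Fin.ext h)
          simp [this, show (2 * (i : ℕ) + 2 ≠ 2 * k + 1) by omega,
            show (2 * (i : ℕ) ≠ 2 * k + 1) by omega]
        · simp)

/-- `a ∧ bⁿ` as an alternating map. -/
def wedgeAlternating (n : ℕ) (a : V →ₗ[ℝ] ℝ) (b : V →ₗ[ℝ] V →ₗ[ℝ] ℝ) :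
    V [⋀^Fin (2 * n + 1)]→ₗ[ℝ] ℝ :=
  (1 / 2 ^ n : ℝ) • MultilinearMap.alternatization (wedgeMultilinear n a b)

lemma wedgeAlternating_apply (n : ℕ) (a : V →ₗ[ℝ] ℝ) (b : V →ₗ[ℝ] V →ₗ[ℝ] ℝ)
    (v : Fin (2 * n + 1) → V) :
    wedgeAlternating n a b v = wedgePow n a (fun x y ↦ b x y) v := by
  simp only [wedgeAlternating, wedgePow, AlternatingMap.smul_apply,
    MultilinearMap.alternatization_apply, smul_eq_mul]
  congr 1
  refine Finset.sum_congr rfl fun σ _ ↦ ?_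
  rw [Units.smul_def, zsmul_eq_mul]
  rfl

/-- The form `a ∧ bⁿ` depends only on the restriction of `b` to the kernel of `a`. -/
lemma wedgePow_congr_of_ker [FiniteDimensional ℝ V] {n : ℕ} (hV : Module.finrank ℝ V = 2 * n + 1)
    (a : V →ₗ[ℝ] ℝ) (b b' : V →ₗ[ℝ] V →ₗ[ℝ] ℝ)
    (h : ∀ x y, a x = 0 → a y = 0 → b x y = b' x y) (v : Fin (2 * n + 1) → V) :
    wedgePow n a (fun x y ↦ b x y) v = wedgePow n a (fun x y ↦ b' x y) v := by
  rw [← wedgeAlternating_apply, ← wedgeAlternating_apply]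
  by_cases ha : a = 0
  · subst ha
    rw [wedgeAlternating_apply, wedgeAlternating_apply]
    simp [wedgePow]
  · obtain ⟨w, hw⟩ : ∃ w, a w ≠ 0 := by
      by_contra! hcon
      exact ha (LinearMap.ext hcon)
    have hk : Module.finrank ℝ (LinearMap.ker a) = 2 * n := by
      have := LinearMap.finrank_range_add_finrank_ker a
      rw [LinearMap.range_eq_top.2 (LinearMap.surjective ha), finrank_top, Module.finrank_self]
        at this
      omega
    let k : Module.Basis (Fin (2 * n)) ℝ (LinearMap.ker a) := Module.finBasisOfFinrankEq ℝ _ hk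
    let e : Module.Basis (Fin (2 * n + 1)) ℝ V := Module.Basis.mkFinCons w k
      (fun c x hx hcx ↦ by
        have : a (c • w + x) = 0 := by rw [hcx, map_zero]
        rw [map_add, map_smul, LinearMap.mem_ker.1 hx, add_zero, smul_eq_mul] at this
        exact (mul_eq_zero.1 this).resolve_right hw)
      (fun z ↦ ⟨-(a z / a w), by simp [LinearMap.mem_ker, hw]⟩)
    have he : ∀ i, i ≠ 0 → a (e i) = 0 := by
      intro i hi
      obtain ⟨j, rfl⟩ := Fin.exists_succ_eq.2 hi
      simp [e]
    congr 1
    refine Module.Basis.ext_alternating e fun f hf ↦ ?_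
    rw [wedgeAlternating_apply, wedgeAlternating_apply, wedgePow, wedgePow]
    congr 1
    refine Finset.sum_congr rfl fun σ _ ↦ ?_
    congr 1
    by_cases h0 : f (σ 0) = 0
    · congr 1
      refine Finset.prod_congr rfl fun i _ ↦ h _ _ (he _ fun h1 ↦ ?_) (he _ fun h1 ↦ ?_) <;>
      · have := σ.injective (hf (h1.trans h0.symm))
        simp [Fin.ext_iff] at this
    · rw [he _ h0, zero_mul, zero_mul]

lemma wedgePow_scale {V W : Type*} (n : ℕ) (c : ℝ) (T : V → W) (a : W → ℝ) (b : W → W → ℝ)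
    (v : Fin (2 * n + 1) → V) :
    wedgePow n (fun x ↦ c * a (T x)) (fun x y ↦ c * b (T x) (T y)) v =
      c ^ (n + 1) * wedgePow n a b (fun i ↦ T (v i)) := by
  simp only [wedgePow, Finset.prod_mul_distrib, Finset.prod_const, Finset.card_univ,
    Fintype.card_fin, Finset.mul_sum]
  refine Finset.sum_congr rfl fun σ _ ↦ ?_
  ring

lemma wedgePow_cons_smul (n : ℕ) (a : V →ₗ[ℝ] ℝ) (b : V →ₗ[ℝ] V →ₗ[ℝ] ℝ) (c : ℝ) (x : V)
    (v : Fin (2 * n) → V) :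
    wedgePow n a (fun x y ↦ b x y) (Fin.cons (c • x) v) =
      c * wedgePow n a (fun x y ↦ b x y) (Fin.cons x v) := by
  rw [← wedgeAlternating_apply, ← wedgeAlternating_apply]
  exact MultilinearMap.cons_smul (wedgeAlternating n a b).toMultilinearMap v c x

lemma continuousAt_wedgePow {X V : Type*} [TopologicalSpace X] (n : ℕ) {a : X → V → ℝ}
    {b : X → V → V → ℝ} {x : X} (ha : ∀ v, ContinuousAt (fun x ↦ a x v) x)
    (hb : ∀ v w, ContinuousAt (fun x ↦ b x v w) x) (v : Fin (2 * n + 1) → V) :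
    ContinuousAt (fun x ↦ wedgePow n (a x) (b x) v) x := by
  unfold wedgePow
  refine continuousAt_const.mul (tendsto_finsetSum _ fun σ _ ↦ continuousAt_const.mul
    ((ha _).mul (tendsto_finsetProd _ fun i _ ↦ hb _ _)))

/-- An alternating `(m+1)`-form contracted with a vector spanning the kernel of `p : V → W` is a
multiple of the pullback by `p` of any nonzero volume form on `W`. -/
lemma alternating_cons_mul_eq {W : Type*} [AddCommGroup W] [Module ℝ W] {m : ℕ}
    (τ : V [⋀^Fin (m + 1)]→ₗ[ℝ] ℝ) (g : V) (p : V →ₗ[ℝ] W) (hker : ∀ v, p v = 0 → ∃ c : ℝ, v = c • g)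
    (e : Module.Basis (Fin m) ℝ W) (l : Fin m → V) (hl : ∀ i, p (l i) = e i)
    (η : W [⋀^Fin m]→ₗ[ℝ] ℝ) (v : Fin m → V) :
    τ (Fin.cons g v) * η e = τ (Fin.cons g l) * η (fun i ↦ p (v i)) := by
  let θ : V [⋀^Fin m]→ₗ[ℝ] ℝ := τ.curryLeft g
  have hθ : ∀ v, θ v = τ (Fin.cons g v) := fun v ↦ rfl
  let s : W →ₗ[ℝ] V := e.constr ℝ l
  have hs : ∀ w, p (s w) = w := by
    intro w
    have : p ∘ₗ s = LinearMap.id := e.ext fun i ↦ by simp [s, hl]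
    exact LinearMap.congr_fun this w
  have hv : ∀ i, ∃ c : ℝ, v i = s (p (v i)) + c • g := by
    intro i
    obtain ⟨c, hc⟩ := hker (v i - s (p (v i))) (by simp [hs])
    exact ⟨c, by rw [← hc]; abel⟩
  choose c hc using hv
  have hzero : ∀ (w : Fin m → V) (i : Fin m), θ (Function.update w i g) = 0 := by
    intro w i
    rw [hθ]
    refine τ.map_eq_zero_of_eq _ (i := 0) (j := i.succ) ?_ (Fin.succ_ne_zero i).symm
    simp
  have hstep : ∀ S : Finset (Fin m), θ (fun i ↦ if i ∈ S then v i else s (p (v i))) =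
      θ (fun i ↦ s (p (v i))) := by
    intro S
    induction S using Finset.induction_on with
    | empty => simp
    | insert j S hj ih =>
      rw [← ih]
      have h1 : (fun i ↦ if i ∈ insert j S then v i else s (p (v i))) =
          Function.update (fun i ↦ if i ∈ S then v i else s (p (v i))) j
            (s (p (v j)) + c j • g) := by
        funext i
        by_cases hij : i = j
        · subst hij; simp [← hc]
        · simp [hij]
      rw [h1, AlternatingMap.map_update_add, AlternatingMap.map_update_smul, hzero, smul_zero,
        add_zero]
      congr 1
      funext i
      by_cases hij : i = j
      · subst hij; simp [hj]
      · simp [hij]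
  have h1 := hstep Finset.univ
  simp only [Finset.mem_univ, if_true] at h1
  have h2 : (θ.compLinearMap s) (fun i ↦ p (v i)) = θ l * e.det (fun i ↦ p (v i)) := by
    rw [(θ.compLinearMap s).eq_smul_basis_det e]
    simp [s]
  have h3 : η (fun i ↦ p (v i)) = η e * e.det (fun i ↦ p (v i)) := by
    conv_lhs => rw [η.eq_smul_basis_det e]
    simp
  rw [AlternatingMap.compLinearMap_apply] at h2
  rw [← hθ, ← hθ, h3, h1, h2]
  ring

end WedgePow

/-! ### Pullbacks of 1-forms to normed spaces -/

section Pullback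

variable {E : Type*} [NormedAddCommGroup E] [NormedSpace ℝ E] {H : Type*} [TopologicalSpace H]
  {I : ModelWithCorners ℝ E H} {M : Type*} [TopologicalSpace M] [ChartedSpace H M]
  {F : Type*} [NormedAddCommGroup F] [NormedSpace ℝ F]

/-- The pullback of a (not necessarily smooth) field of covectors under a map from a normed
space. -/
def pullbackCovector (α : ∀ x : M, TangentSpace I x →L[ℝ] ℝ) (φ : F → M) (y : F) : F →L[ℝ] ℝ :=
  (α (φ y)).comp (mfderiv 𝓘(ℝ, F) I φ y : F →L[ℝ] _)

variable [IsManifold I ∞ M] [I.Boundaryless]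

lemma contMDiffAt_covector_iff (α : ∀ x : M, TangentSpace I x →L[ℝ] ℝ) (x₀ : M) :
    ContMDiffAt I (I.prod 𝓘(ℝ, E →L[ℝ] ℝ)) ∞
      (fun x ↦ TotalSpace.mk' (E →L[ℝ] ℝ) (E := fun x : M ↦ TangentSpace I x →L[ℝ] ℝ) x (α x)) x₀ ↔
    ContDiffAt ℝ ∞ (pullbackCovector α (extChartAt I x₀).symm) (extChartAt I x₀ x₀) := by
  rw [contMDiffAt_hom_bundle]
  have hev : (fun x ↦ ContinuousLinearMap.inCoordinates E (TangentSpace I) ℝ (Bundle.Trivial M ℝ)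
      x₀ x x₀ x (α x)) =ᶠ[𝓝 x₀]
      fun x ↦ pullbackCovector α (extChartAt I x₀).symm (extChartAt I x₀ x) := by
    filter_upwards [(chartAt H x₀).open_source.mem_nhds (mem_chart_source H x₀)] with x hx
    ext v
    have hx' : (extChartAt I x₀).symm (extChartAt I x₀ x) = x :=
      (extChartAt I x₀).left_inv (by simpa using hx)
    have : ∀ x', x' = x → (α x : E →L[ℝ] ℝ) = α x' := by rintro _ rfl; rfl
    have hid : (trivializationAt ℝ (Bundle.Trivial M ℝ) x₀).continuousLinearMapAt ℝ x =
        ContinuousLinearMap.id ℝ ℝ := Bundle.Trivial.continuousLinearMapAt_trivialization ℝ M ℝ x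
    rw [ContinuousLinearMap.inCoordinates, hid, TangentBundle.symmL_trivializationAt hx,
      I.range_eq_univ, mfderivWithin_univ]
    exact congrArg (fun a : E →L[ℝ] ℝ ↦ a
      (mfderiv 𝓘(ℝ, E) I (extChartAt I x₀).symm (extChartAt I x₀ x) v)) (this _ hx')
  rw [Filter.EventuallyEq.contMDiffAt_iff hev]
  refine (and_iff_right (contMDiffAt_id : ContMDiffAt I I ∞ (fun x : M ↦ x) x₀)).trans ?_
  rw [contMDiffAt_iff_source, I.range_eq_univ, contMDiffWithinAt_univ,
    contMDiffAt_iff_contDiffAt]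
  have hev' : (fun x ↦ pullbackCovector α (extChartAt I x₀).symm (extChartAt I x₀ x)) ∘
      (extChartAt I x₀).symm =ᶠ[𝓝 (extChartAt I x₀ x₀)]
      pullbackCovector α (extChartAt I x₀).symm := by
    filter_upwards [extChartAt_target_mem_nhds (I := I) x₀] with y hy
    simp only [Function.comp_apply]
    rw [(extChartAt I x₀).right_inv hy]
  exact ⟨fun h ↦ h.congr_of_eventuallyEq hev'.symm, fun h ↦ h.congr_of_eventuallyEq hev'⟩

lemma OneForm.contDiffAt_localRep (α : OneForm I M) (x₀ : M) :
    ContDiffAt ℝ ∞ (α.localRep x₀) (extChartAt I x₀ x₀) :=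
  (contMDiffAt_covector_iff _ _).1 (α.smooth x₀)

lemma OneForm.pullback_eventuallyEq (α : OneForm I M) {φ : F → M} {y₀ : F}
    (hφ : ContMDiffAt 𝓘(ℝ, F) I ∞ φ y₀) :
    pullbackCovector α.toFun φ =ᶠ[𝓝 y₀] fun y ↦
      (α.localRep (φ y₀) (extChartAt I (φ y₀) (φ y))).comp
        (fderiv ℝ (fun y ↦ extChartAt I (φ y₀) (φ y)) y) := by
  have hd : ∀ᶠ y in 𝓝 y₀, ContMDiffAt 𝓘(ℝ, F) I 1 φ y :=
    (contMDiffAt_iff_contMDiffAt_nhds (by decide)).1 (hφ.of_le (by norm_cast))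
  have hs : ∀ᶠ y in 𝓝 y₀, φ y ∈ (extChartAt I (φ y₀)).source :=
    hφ.continuousAt.eventually (extChartAt_source_mem_nhds (I := I) (φ y₀))
  filter_upwards [hd, hs, hs.eventually_nhds] with y hyd hys hyn
  ext v
  set e := extChartAt I (φ y₀)
  have h1 : φ =ᶠ[𝓝 y] e.symm ∘ (fun y ↦ e (φ y)) := by
    filter_upwards [hyn] with z hz
    exact (e.left_inv hz).symm
  have he : MDifferentiableAt 𝓘(ℝ, F) 𝓘(ℝ, E) (fun y ↦ e (φ y)) y :=
    ((contMDiffAt_extChartAt' (by simpa [e] using hys)).comp y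
      hyd : ContMDiffAt 𝓘(ℝ, F) 𝓘(ℝ, E) 1 (fun y ↦ e (φ y)) y).mdifferentiableAt (by decide)
  have hes : MDifferentiableAt 𝓘(ℝ, E) I e.symm (e (φ y)) :=
    ((contMDiffOn_extChartAt_symm (n := 1) (φ y₀)).contMDiffAt
      (extChartAt_target_mem_nhds' (e.map_source hys))).mdifferentiableAt (by decide)
  have h2 : (mfderiv 𝓘(ℝ, F) I φ y : F →L[ℝ] E) =
      (mfderiv 𝓘(ℝ, E) I e.symm (e (φ y)) : E →L[ℝ] E).comp
        (fderiv ℝ (fun y ↦ e (φ y)) y) := by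
    rw [h1.mfderiv_eq, mfderiv_comp y hes he, mfderiv_eq_fderiv]
    rfl
  have : ∀ x', x' = φ y → (α.toFun (φ y) : E →L[ℝ] ℝ) = α.toFun x' := by rintro _ rfl; rfl
  change (α.toFun (φ y) : E →L[ℝ] ℝ) ((mfderiv 𝓘(ℝ, F) I φ y : F →L[ℝ] E) v) =
    (α.toFun (e.symm (e (φ y))) : E →L[ℝ] ℝ) ((mfderiv 𝓘(ℝ, E) I e.symm (e (φ y)) : E →L[ℝ] E)
      (fderiv ℝ (fun y ↦ e (φ y)) y v))
  rw [h2, this _ (e.left_inv hys)]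
  rfl

omit [IsManifold I ∞ M] [I.Boundaryless] in
lemma contDiffAt_extChartAt_comp {φ : F → M} {y₀ : F} (hφ : ContMDiffAt 𝓘(ℝ, F) I ∞ φ y₀) :
    ContDiffAt ℝ ∞ (fun y ↦ extChartAt I (φ y₀) (φ y)) y₀ :=
  contMDiffAt_iff_contDiffAt.1 ((contMDiffAt_extChartAt (x := φ y₀)).comp y₀ hφ)

lemma OneForm.contDiffAt_pullback (α : OneForm I M) {φ : F → M} {y₀ : F}
    (hφ : ContMDiffAt 𝓘(ℝ, F) I ∞ φ y₀) :
    ContDiffAt ℝ ∞ (pullbackCovector α.toFun φ) y₀ := by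
  have hg := contDiffAt_extChartAt_comp hφ
  have hL : ContDiffAt ℝ ∞ (fun y ↦ α.localRep (φ y₀) (extChartAt I (φ y₀) (φ y))) y₀ :=
    ContDiffAt.comp (f := fun y ↦ extChartAt I (φ y₀) (φ y)) y₀ (α.contDiffAt_localRep (φ y₀)) hg
  exact (hL.clm_comp (hg.fderiv_right (by norm_cast))).congr_of_eventuallyEq (α.pullback_eventuallyEq hφ)

/-- The exterior derivative commutes with pullbacks. -/
lemma OneForm.extDeriv_pullback (α : OneForm I M) {φ : F → M} {y₀ : F}
    (hφ : ContMDiffAt 𝓘(ℝ, F) I ∞ φ y₀) (v w : F) :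
    α.extDeriv (φ y₀) (mfderiv 𝓘(ℝ, F) I φ y₀ v) (mfderiv 𝓘(ℝ, F) I φ y₀ w) =
      fderiv ℝ (pullbackCovector α.toFun φ) y₀ v w -
        fderiv ℝ (pullbackCovector α.toFun φ) y₀ w v := by
  have hg := contDiffAt_extChartAt_comp hφ
  have hL := α.contDiffAt_localRep (φ y₀)
  have hm : (mfderiv 𝓘(ℝ, F) I φ y₀ : F →L[ℝ] E) =
      fderiv ℝ (fun y ↦ extChartAt I (φ y₀) (φ y)) y₀ := by
    have h1 := mfderiv_comp (I := 𝓘(ℝ, F)) (I' := I) (I'' := 𝓘(ℝ, E)) y₀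
      (mdifferentiableAt_extChartAt (I := I) (mem_chart_source H (φ y₀)))
      (hφ.mdifferentiableAt (by decide))
    rw [mfderiv_extChartAt_self] at h1
    rw [← mfderiv_eq_fderiv]
    exact h1.symm
  rw [(α.pullback_eventuallyEq hφ).fderiv_eq]
  set g := fun y ↦ extChartAt I (φ y₀) (φ y)
  have hgd : DifferentiableAt ℝ g y₀ := hg.differentiableAt (by decide)
  have hfd : DifferentiableAt ℝ (fderiv ℝ g) y₀ :=
    (hg.fderiv_right (m := 1) (by norm_cast)).differentiableAt (by decide)
  have hLd : DifferentiableAt ℝ (α.localRep (φ y₀)) (g y₀) := hL.differentiableAt (by decide)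
  have hc : HasFDerivAt (fun y ↦ α.localRep (φ y₀) (g y))
      ((fderiv ℝ (α.localRep (φ y₀)) (g y₀)).comp (fderiv ℝ g y₀)) y₀ :=
    hLd.hasFDerivAt.comp y₀ hgd.hasFDerivAt
  rw [(hc.clm_comp hfd.hasFDerivAt).fderiv]
  have hsymm : fderiv ℝ (fderiv ℝ g) y₀ v w = fderiv ℝ (fderiv ℝ g) y₀ w v :=
    (hg.isSymmSndFDerivAt (by simp; norm_cast)) v w
  have hkey : ∀ v w : F, α.extDeriv (φ y₀) (fderiv ℝ g y₀ v) (fderiv ℝ g y₀ w) =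
      fderiv ℝ (α.localRep (φ y₀)) (g y₀) (fderiv ℝ g y₀ v) (fderiv ℝ g y₀ w) -
      fderiv ℝ (α.localRep (φ y₀)) (g y₀) (fderiv ℝ g y₀ w) (fderiv ℝ g y₀ v) := fun v w ↦ rfl
  have hm' : ∀ v, mfderiv 𝓘(ℝ, F) I φ y₀ v = fderiv ℝ g y₀ v := fun v ↦ DFunLike.congr_fun hm v
  refine (congrArg₂ (α.extDeriv (φ y₀)) (hm' v) (hm' w)).trans ((hkey v w).trans ?_)
  simp [hsymm]

/-- The alternating bilinear form `dψ` at a point, for a 1-form `ψ` on a normed space. -/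
def dForm (ψ : F → F →L[ℝ] ℝ) (y : F) : F →ₗ[ℝ] F →ₗ[ℝ] ℝ :=
  LinearMap.mk₂ ℝ (fun v w ↦ fderiv ℝ ψ y v w - fderiv ℝ ψ y w v)
    (fun _ _ _ ↦ by simp; ring) (fun _ _ _ ↦ by simp; ring) (fun _ _ _ ↦ by simp; ring)
    (fun _ _ _ ↦ by simp; ring)

lemma dForm_apply (ψ : F → F →L[ℝ] ℝ) (y v w : F) :
    dForm ψ y v w = fderiv ℝ ψ y v w - fderiv ℝ ψ y w v := rfl

lemma OneForm.contactVolume_pullback (α : OneForm I M) (n : ℕ) {φ : F → M} {y₀ : F}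
    (hφ : ContMDiffAt 𝓘(ℝ, F) I ∞ φ y₀) (v : Fin (2 * n + 1) → F) :
    α.contactVolume n (φ y₀) (fun i ↦ mfderiv 𝓘(ℝ, F) I φ y₀ (v i)) =
      wedgePow n (pullbackCovector α.toFun φ y₀)
        (fun x y ↦ dForm (pullbackCovector α.toFun φ) y₀ x y) v := by
  simp only [OneForm.contactVolume, wedgePow, α.extDeriv_pullback hφ]
  rfl

/-- `α ∧ (dα)ⁿ` at a point, as an alternating map. -/
def OneForm.contactAlternating (α : OneForm I M) (n : ℕ) (x : M) :
    TangentSpace I x [⋀^Fin (2 * n + 1)]→ₗ[ℝ] ℝ :=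
  wedgeAlternating n (α.toFun x : TangentSpace I x →ₗ[ℝ] ℝ)
    (dForm (α.localRep x) (extChartAt I x x) : E →ₗ[ℝ] E →ₗ[ℝ] ℝ)

omit [I.Boundaryless] in
lemma OneForm.contactAlternating_apply (α : OneForm I M) (n : ℕ) (x : M)
    (v : Fin (2 * n + 1) → TangentSpace I x) :
    α.contactAlternating n x v = α.contactVolume n x v :=
  wedgeAlternating_apply _ _ _ _

end Pullback

lemma contMDiff_circle_coe : ContMDiff (𝓡 1) 𝓘(ℝ, ℂ) ∞ (fun z : Circle ↦ (z : ℂ)) :=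
  haveI : Fact (Module.finrank ℝ ℂ = 1 + 1) := finrank_real_complex_fact'
  contMDiff_coe_sphere

/-! ### Geometry of principal circle bundles -/

section Geometry

variable {n : ℕ} {B : Type*} [TopologicalSpace B]
  [ChartedSpace (EuclideanSpace ℝ (Fin (2 * n))) B]
  {E : Type*} [NormedAddCommGroup E] [NormedSpace ℝ E]
  {H : Type*} [TopologicalSpace H] {I : ModelWithCorners ℝ E H}
  {M : Type*} [TopologicalSpace M] [ChartedSpace H M]
  (P : PrincipalCircleBundle (𝓡 (2 * n)) B I M)

namespace PrincipalCircleBundle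

lemma exists_proj_eq (b : B) : ∃ x, P.proj x = b := by
  obtain ⟨e, hb, -⟩ := P.exists_trivialization b
  exact ⟨e.toOpenPartialHomeomorph.symm (b, 1), e.proj_symm_apply' hb⟩

lemma exists_act_eq {x x' : M} (h : P.proj x = P.proj x') : ∃ z, P.act z x = x' := by
  obtain ⟨e, hb, -, -, he⟩ := P.exists_trivialization (P.proj x)
  have hx : x ∈ e.source := e.mem_source.2 hb
  have hx' : x' ∈ e.source := e.mem_source.2 (h ▸ hb)
  refine ⟨(e x').2 * ((e x).2)⁻¹, ?_⟩
  have hs : P.act ((e x').2 * ((e x).2)⁻¹) x ∈ e.source := e.mem_source.2 (by rwa [P.proj_act])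
  have key : e (P.act ((e x').2 * ((e x).2)⁻¹) x) = e x' := by
    refine Prod.ext ?_ ?_
    · rw [e.coe_fst hx', e.coe_fst hs, P.proj_act, h]
    · rw [he _ _ hx, inv_mul_cancel_right]
  exact e.injOn hs hx' key

lemma contMDiff_act (z : Circle) : ContMDiff I I ∞ (P.act z) :=
  P.smooth_act.comp (contMDiff_const.prodMk contMDiff_id)

lemma contMDiff_orbit (x : M) : ContMDiff 𝓘(ℝ, ℝ) I ∞ (fun t : ℝ ↦ P.act (Circle.exp t) x) :=
  P.smooth_act.comp (contMDiff_circleExp.prodMk contMDiff_const)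

lemma mdifferentiableAt_act (z : Circle) (x : M) : MDifferentiableAt I I (P.act z) x :=
  (P.contMDiff_act z).mdifferentiableAt (by decide)

lemma mfderiv_act_generator (z : Circle) (x : M) :
    (mfderiv I I (P.act z) x : E →L[ℝ] E) (P.generator x) = P.generator (P.act z x) := by
  have h0 : P.act (Circle.exp 0) x = x := by rw [Circle.exp_zero, P.one_act]
  have hc : (fun t : ℝ ↦ P.act (Circle.exp t) (P.act z x)) =
      P.act z ∘ fun t : ℝ ↦ P.act (Circle.exp t) x := by
    funext t
    simp only [Function.comp_apply, ← P.mul_act, mul_comm]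
  have hd := mfderiv_comp (0 : ℝ) (P.mdifferentiableAt_act z (P.act (Circle.exp 0) x))
    ((P.contMDiff_orbit x).mdifferentiableAt (by decide))
  rw [← hc] at hd
  have h1 : ∀ x', x' = x → (mfderiv I I (P.act z) x' : E →L[ℝ] E) = mfderiv I I (P.act z) x := by
    rintro _ rfl; rfl
  rw [← h1 _ h0]
  exact (DFunLike.congr_fun hd (1 : ℝ)).symm

lemma mfderiv_act_inv_act (z : Circle) (x : M) (v : TangentSpace I x) :
    (mfderiv I I (P.act z⁻¹) (P.act z x) : E →L[ℝ] E) (mfderiv I I (P.act z) x v) = v := by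
  have hc : P.act z⁻¹ ∘ P.act z = id := by
    funext x
    simp only [Function.comp_apply, ← P.mul_act, inv_mul_cancel, P.one_act, id]
  have hd := mfderiv_comp x (P.mdifferentiableAt_act z⁻¹ (P.act z x)) (P.mdifferentiableAt_act z x)
  rw [hc, mfderiv_id] at hd
  exact (DFunLike.congr_fun hd v).symm

lemma mfderiv_act_act_inv (z : Circle) (x : M) (v : TangentSpace I (P.act z x)) :
    (mfderiv I I (P.act z) x : E →L[ℝ] E)
      ((mfderiv I I (P.act z⁻¹) (P.act z x) : E →L[ℝ] E) v) = v := by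
  have h := P.mfderiv_act_inv_act z⁻¹ (P.act z x) v
  have h1 : ∀ z' x', z' = z → x' = x →
      (mfderiv I I (P.act z') x' : E →L[ℝ] E) = mfderiv I I (P.act z) x := by
    rintro _ _ rfl rfl; rfl
  rw [h1 _ _ (inv_inv z) (by rw [← P.mul_act, inv_mul_cancel, P.one_act])] at h
  exact h

/-- The parametrization `(y, t) ↦ e^{it} · σ(y)` of the total space determined by a local section
`σ`. -/
def param (σ : EuclideanSpace ℝ (Fin (2 * n)) → M) (p : EuclideanSpace ℝ (Fin (2 * n)) × ℝ) : M :=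
  P.act (Circle.exp p.2) (σ p.1)

/-- `σ` is a smooth local section over the image in `B` of the open subset `O` of the chart at
`b₀`. -/
structure IsLocalSection (b₀ : B) (O : Set (EuclideanSpace ℝ (Fin (2 * n))))
    (σ : EuclideanSpace ℝ (Fin (2 * n)) → M) : Prop where
  isOpen : IsOpen O
  mem : extChartAt (𝓡 (2 * n)) b₀ b₀ ∈ O
  subset_target : O ⊆ (extChartAt (𝓡 (2 * n)) b₀).target
  smooth : ∀ y ∈ O, ContMDiffAt 𝓘(ℝ, EuclideanSpace ℝ (Fin (2 * n))) I ∞ σ y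
  proj_eq : ∀ y ∈ O, P.proj (σ y) = (extChartAt (𝓡 (2 * n)) b₀).symm y

namespace IsLocalSection

variable {P} {b₀ : B} {O : Set (EuclideanSpace ℝ (Fin (2 * n)))}
  {σ : EuclideanSpace ℝ (Fin (2 * n)) → M} (hσ : P.IsLocalSection b₀ O σ)

include hσ

lemma mem_nhds {y : EuclideanSpace ℝ (Fin (2 * n))} (hy : y ∈ O) : O ∈ 𝓝 y :=
  hσ.isOpen.mem_nhds hy

lemma contMDiffAt_param {y : EuclideanSpace ℝ (Fin (2 * n))} (hy : y ∈ O) (t : ℝ) :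
    ContMDiffAt 𝓘(ℝ, EuclideanSpace ℝ (Fin (2 * n)) × ℝ) I ∞ (P.param σ) (y, t) := by
  have h1 : ContMDiffAt 𝓘(ℝ, EuclideanSpace ℝ (Fin (2 * n)) × ℝ) (𝓡 1) ∞
      (fun p : EuclideanSpace ℝ (Fin (2 * n)) × ℝ ↦ Circle.exp p.2) (y, t) :=
    contMDiff_circleExp.contMDiffAt.comp _ contDiff_snd.contMDiff.contMDiffAt
  have h2 : ContMDiffAt 𝓘(ℝ, EuclideanSpace ℝ (Fin (2 * n)) × ℝ) I ∞
      (fun p : EuclideanSpace ℝ (Fin (2 * n)) × ℝ ↦ σ p.1) (y, t) :=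
    ContMDiffAt.comp (y, t) (hσ.smooth y hy) contDiff_fst.contMDiff.contMDiffAt
  exact P.smooth_act.contMDiffAt.comp (y, t) (h1.prodMk h2)

lemma mdifferentiableAt_param {y : EuclideanSpace ℝ (Fin (2 * n))} (hy : y ∈ O) (t : ℝ) :
    MDifferentiableAt 𝓘(ℝ, EuclideanSpace ℝ (Fin (2 * n)) × ℝ) I (P.param σ) (y, t) :=
  (hσ.contMDiffAt_param hy t).mdifferentiableAt (by decide)

lemma proj_param {y : EuclideanSpace ℝ (Fin (2 * n))} (hy : y ∈ O) (t : ℝ) :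
    P.proj (P.param σ (y, t)) = (extChartAt (𝓡 (2 * n)) b₀).symm y := by
  rw [param, P.proj_act, hσ.proj_eq y hy]

lemma mfderiv_param_snd {y : EuclideanSpace ℝ (Fin (2 * n))} (hy : y ∈ O) (t : ℝ) :
    (mfderiv 𝓘(ℝ, EuclideanSpace ℝ (Fin (2 * n)) × ℝ) I (P.param σ) (y, t) : _ →L[ℝ] E)
      (0, (1 : ℝ)) = P.generator (P.param σ (y, t)) := by
  have hc : (fun s : ℝ ↦ P.act (Circle.exp s) (P.param σ (y, t))) =
      P.param σ ∘ fun s : ℝ ↦ (y, s + t) := by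
    funext s
    simp only [Function.comp_apply, param, ← P.mul_act, Circle.exp_add]
  have hg : HasFDerivAt (fun s : ℝ ↦ (y, s + t))
      ((0 : ℝ →L[ℝ] EuclideanSpace ℝ (Fin (2 * n))).prod (ContinuousLinearMap.id ℝ ℝ)) 0 :=
    (hasFDerivAt_const y 0).prodMk ((hasFDerivAt_id 0).add_const t)
  have h0 : ((y, 0 + t) : EuclideanSpace ℝ (Fin (2 * n)) × ℝ) = (y, t) := by rw [zero_add]
  have hd := mfderiv_comp (0 : ℝ) (h0 ▸ hσ.mdifferentiableAt_param hy t :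
    MDifferentiableAt 𝓘(ℝ, EuclideanSpace ℝ (Fin (2 * n)) × ℝ) I (P.param σ) (y, 0 + t))
    hg.differentiableAt.mdifferentiableAt
  rw [← hc, mfderiv_eq_fderiv, hg.fderiv] at hd
  have h1 : ∀ p, p = (y, t) →
      (mfderiv 𝓘(ℝ, EuclideanSpace ℝ (Fin (2 * n)) × ℝ) I (P.param σ) p : _ →L[ℝ] E) =
        mfderiv 𝓘(ℝ, EuclideanSpace ℝ (Fin (2 * n)) × ℝ) I (P.param σ) (y, t) := by
    rintro _ rfl; rfl
  rw [← h1 _ h0]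
  exact (DFunLike.congr_fun hd (1 : ℝ)).symm

variable [IsManifold (𝓡 (2 * n)) ∞ B]

lemma mdifferentiableAt_chart_symm {y : EuclideanSpace ℝ (Fin (2 * n))} (hy : y ∈ O) :
    MDifferentiableAt 𝓘(ℝ, EuclideanSpace ℝ (Fin (2 * n))) (𝓡 (2 * n))
      (extChartAt (𝓡 (2 * n)) b₀).symm y :=
  ((contMDiffOn_extChartAt_symm (n := 1) b₀).contMDiffAt
    (extChartAt_target_mem_nhds' (hσ.subset_target hy))).mdifferentiableAt (by decide)

lemma mfderiv_proj_mfderiv_param {y : EuclideanSpace ℝ (Fin (2 * n))} (hy : y ∈ O) (t : ℝ)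
    (v : EuclideanSpace ℝ (Fin (2 * n)) × ℝ) :
    (mfderiv I (𝓡 (2 * n)) P.proj (P.param σ (y, t)) : E →L[ℝ] EuclideanSpace ℝ (Fin (2 * n)))
      (mfderiv 𝓘(ℝ, EuclideanSpace ℝ (Fin (2 * n)) × ℝ) I (P.param σ) (y, t) v) =
    mfderiv 𝓘(ℝ, EuclideanSpace ℝ (Fin (2 * n))) (𝓡 (2 * n))
      (extChartAt (𝓡 (2 * n)) b₀).symm y v.1 := by
  have h1 := mfderiv_comp (y, t)
    (P.smooth_proj.mdifferentiableAt (x := P.param σ (y, t)) (by decide))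
    (hσ.mdifferentiableAt_param hy t)
  have h2 := mfderiv_comp (I := 𝓘(ℝ, EuclideanSpace ℝ (Fin (2 * n)) × ℝ))
    (f := fun p : EuclideanSpace ℝ (Fin (2 * n)) × ℝ ↦ p.1) (y, t)
    (hσ.mdifferentiableAt_chart_symm hy) differentiableAt_fst.mdifferentiableAt
  have he : P.proj ∘ P.param σ =ᶠ[𝓝 (y, t)] (extChartAt (𝓡 (2 * n)) b₀).symm ∘
      fun p : EuclideanSpace ℝ (Fin (2 * n)) × ℝ ↦ p.1 := by
    filter_upwards [continuousAt_fst (p := (y, t)) (hσ.mem_nhds hy)] with p hp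
    exact hσ.proj_param hp p.2
  rw [he.mfderiv_eq, h2, mfderiv_eq_fderiv, fderiv_fst] at h1
  exact (DFunLike.congr_fun h1 v).symm

lemma exists_basis {y : EuclideanSpace ℝ (Fin (2 * n))} (hy : y ∈ O) :
    ∃ e : Module.Basis (Fin (2 * n)) ℝ (EuclideanSpace ℝ (Fin (2 * n))), ∀ i,
      e i = (mfderiv 𝓘(ℝ, EuclideanSpace ℝ (Fin (2 * n))) (𝓡 (2 * n))
        (extChartAt (𝓡 (2 * n)) b₀).symm y : _ →L[ℝ] EuclideanSpace ℝ (Fin (2 * n)))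
          (EuclideanSpace.basisFun (Fin (2 * n)) ℝ i) := by
  have h := isInvertible_mfderivWithin_extChartAt_symm (I := 𝓡 (2 * n)) (hσ.subset_target hy)
  rw [ModelWithCorners.range_eq_univ, mfderivWithin_univ] at h
  obtain ⟨L, hL⟩ := h
  let L' : EuclideanSpace ℝ (Fin (2 * n)) ≃L[ℝ] EuclideanSpace ℝ (Fin (2 * n)) := L
  refine ⟨(EuclideanSpace.basisFun (Fin (2 * n)) ℝ).toBasis.map L'.toLinearEquiv, fun i ↦ ?_⟩
  rw [← hL]
  simp [L']
  rfl

end IsLocalSection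

lemma exists_isLocalSection [IsManifold (𝓡 (2 * n)) ∞ B] (b₀ : B) :
    ∃ (O : Set (EuclideanSpace ℝ (Fin (2 * n)))) (σ : EuclideanSpace ℝ (Fin (2 * n)) → M),
      P.IsLocalSection b₀ O σ ∧ ∀ y ∈ O, ∀ t : ℝ, Function.Surjective
        (mfderiv 𝓘(ℝ, EuclideanSpace ℝ (Fin (2 * n)) × ℝ) I (P.param σ) (y, t) : _ →L[ℝ] E) := by
  obtain ⟨e, hb, hes, het, he⟩ := P.exists_trivialization b₀
  set c := extChartAt (𝓡 (2 * n)) b₀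
  have hO : IsOpen (c.target ∩ c.symm ⁻¹' e.baseSet) :=
    (continuousOn_extChartAt_symm b₀).isOpen_inter_preimage (isOpen_extChartAt_target b₀)
      e.open_baseSet
  let σ : EuclideanSpace ℝ (Fin (2 * n)) → M := fun y ↦ e.toOpenPartialHomeomorph.symm (c.symm y, 1)
  have hσ : P.IsLocalSection b₀ (c.target ∩ c.symm ⁻¹' e.baseSet) σ := by
    refine ⟨hO, ⟨mem_extChartAt_target b₀, ?_⟩, Set.inter_subset_left, ?_, ?_⟩
    · rw [Set.mem_preimage, extChartAt_to_inv]
      exact hb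
    · rintro y ⟨hy, hyb⟩
      have h1 : ContMDiffAt 𝓘(ℝ, EuclideanSpace ℝ (Fin (2 * n))) ((𝓡 (2 * n)).prod (𝓡 1)) ∞
          (fun y ↦ (c.symm y, (1 : Circle))) y :=
        ((contMDiffOn_extChartAt_symm b₀).contMDiffAt (extChartAt_target_mem_nhds' hy)).prodMk
          contMDiffAt_const
      have h2 := het.contMDiffAt (e.open_target.mem_nhds
        (e.mem_target.2 hyb : (c.symm y, (1 : Circle)) ∈ e.target))
      exact h2.comp y h1
    · rintro y ⟨hy, hyb⟩
      exact e.proj_symm_apply' hyb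
  refine ⟨_, σ, hσ, fun y hy t ↦ ?_⟩
  have hσs : σ y ∈ e.source := e.mem_source.2 (by rw [hσ.proj_eq y hy]; exact hy.2)
  set x₁ := P.param σ (y, t)
  have hx₁ : x₁ ∈ e.source := e.mem_source.2 (by rw [hσ.proj_param hy]; exact hy.2)
  have heσ : ∀ z ∈ c.target ∩ c.symm ⁻¹' e.baseSet, e (σ z) = (c.symm z, 1) := fun z hz ↦
    e.apply_symm_apply' hz.2
  let a : M → Circle := fun x ↦ (e x).2 * (Circle.exp t)⁻¹
  have ha₁ : a x₁ = 1 := by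
    change (e (P.act (Circle.exp t) (σ y))).2 * _ = 1
    rw [he _ _ hσs, heσ y hy, mul_one, mul_inv_cancel]
  let Ψ : M → EuclideanSpace ℝ (Fin (2 * n)) × ℝ := fun x ↦
    (c (P.proj x), t + (Complex.log (a x : ℂ)).im)
  have hp₁ : P.proj x₁ = c.symm y := hσ.proj_param hy t
  have hΨ₁ : Ψ x₁ = (y, t) := by
    simp only [Ψ, ha₁, hp₁, c.right_inv hy.1]
    simp
  have hΨ : MDifferentiableAt I 𝓘(ℝ, EuclideanSpace ℝ (Fin (2 * n)) × ℝ) Ψ x₁ := by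
    have h1 : ContMDiffAt I 𝓘(ℝ, EuclideanSpace ℝ (Fin (2 * n))) ∞ (fun x ↦ c (P.proj x)) x₁ :=
      ContMDiffAt.comp x₁ (contMDiffAt_extChartAt' (n := ∞) (by
        rw [hp₁, ← extChartAt_source (I := 𝓡 (2 * n))]
        exact c.map_target hy.1)) P.smooth_proj.contMDiffAt
    have h2 : ContMDiffAt I (𝓡 1) ∞ a x₁ :=
      (contMDiff_snd.contMDiffAt.comp x₁ (hes.contMDiffAt (e.open_source.mem_nhds hx₁))).mul
        contMDiffAt_const
    have h3 : ContMDiffAt I 𝓘(ℝ, ℂ) ∞ (fun x ↦ (a x : ℂ)) x₁ :=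
      contMDiff_circle_coe.contMDiffAt.comp x₁ h2
    have h4 : ContDiffAt ℝ ∞ (fun z : ℂ ↦ t + (Complex.log z).im) (a x₁) := by
      have : ContDiffAt ℂ ∞ Complex.log (a x₁) := by
        rw [ha₁]
        exact Complex.contDiffAt_log (by simp)
      exact contDiffAt_const.add
        (Complex.imCLM.contDiff.contDiffAt.comp _ (this.restrict_scalars ℝ))
    have h5 : ContMDiffAt I 𝓘(ℝ, ℝ) ∞ (fun x ↦ t + (Complex.log (a x : ℂ)).im) x₁ :=
      ContMDiffAt.comp (f := fun x ↦ (a x : ℂ)) x₁ h4.contMDiffAt h3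
    exact (h1.prodMk_space h5).mdifferentiableAt (by decide)
  have hid : P.param σ ∘ Ψ =ᶠ[𝓝 x₁] id := by
    have hev : ∀ᶠ x in 𝓝 x₁, c (P.proj x) ∈ c.target ∩ c.symm ⁻¹' e.baseSet := by
      have hcont : ContinuousAt (fun x ↦ c (P.proj x)) x₁ :=
        ContinuousAt.comp (g := c) (by
          rw [hp₁]
          exact continuousAt_extChartAt' (c.map_target hy.1)) P.smooth_proj.continuous.continuousAt
      refine hcont (hO.mem_nhds ?_)
      dsimp only
      rw [hp₁, c.right_inv hy.1]
      exact hy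
    have hev' : ∀ᶠ x in 𝓝 x₁, P.proj x ∈ c.source :=
      P.smooth_proj.continuous.continuousAt.eventually
        ((isOpen_extChartAt_source b₀).mem_nhds (by rw [hp₁]; exact c.map_target hy.1))
    filter_upwards [e.open_source.mem_nhds hx₁, hev, hev'] with x hx hxO hxc
    have hs : σ (c (P.proj x)) ∈ e.source :=
      e.mem_source.2 (by rw [hσ.proj_eq _ hxO]; exact hxO.2)
    have hs' : P.param σ (Ψ x) ∈ e.source := e.mem_source.2 (by
      rw [hσ.proj_param hxO]; exact hxO.2)
    have hl : Circle.exp (t + (Complex.log (a x : ℂ)).im) = (e x).2 := by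
      rw [Circle.exp_add, Complex.log_im, Circle.exp_arg]
      simp [a]
    have key : e (P.param σ (Ψ x)) = e x := by
      refine Prod.ext ?_ ?_
      · rw [e.coe_fst hx, e.coe_fst hs', hσ.proj_param hxO, c.left_inv hxc]
      · change (e (P.act (Circle.exp (t + (Complex.log (a x : ℂ)).im)) (σ (c (P.proj x))))).2 = _
        rw [he _ _ hs, heσ _ hxO, hl, mul_one]
    exact e.injOn hs' hx key
  have hd := mfderiv_comp x₁ (hΨ₁ ▸ hσ.mdifferentiableAt_param hy t :
    MDifferentiableAt 𝓘(ℝ, EuclideanSpace ℝ (Fin (2 * n)) × ℝ) I (P.param σ) (Ψ x₁)) hΨ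
  rw [hid.mfderiv_eq, mfderiv_id] at hd
  have h1 : ∀ p, p = (y, t) →
      (mfderiv 𝓘(ℝ, EuclideanSpace ℝ (Fin (2 * n)) × ℝ) I (P.param σ) p : _ →L[ℝ] E) =
        mfderiv 𝓘(ℝ, EuclideanSpace ℝ (Fin (2 * n)) × ℝ) I (P.param σ) (y, t) := by
    rintro _ rfl; rfl
  intro v
  refine ⟨mfderiv I 𝓘(ℝ, EuclideanSpace ℝ (Fin (2 * n)) × ℝ) Ψ x₁ v, ?_⟩
  rw [← h1 _ hΨ₁]
  exact (DFunLike.congr_fun hd v).symm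

lemma IsLocalSection.exists_smul_generator [IsManifold (𝓡 (2 * n)) ∞ B]
    {P : PrincipalCircleBundle (𝓡 (2 * n)) B I M} {b₀ : B}
    {O : Set (EuclideanSpace ℝ (Fin (2 * n)))} {σ : EuclideanSpace ℝ (Fin (2 * n)) → M}
    (hσ : P.IsLocalSection b₀ O σ) {y : EuclideanSpace ℝ (Fin (2 * n))} (hy : y ∈ O) {t : ℝ}
    (hsurj : Function.Surjective
      (mfderiv 𝓘(ℝ, EuclideanSpace ℝ (Fin (2 * n)) × ℝ) I (P.param σ) (y, t) : _ →L[ℝ] E))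
    (v : E) (hv : (mfderiv I (𝓡 (2 * n)) P.proj (P.param σ (y, t)) :
      E →L[ℝ] EuclideanSpace ℝ (Fin (2 * n))) v = 0) :
    ∃ c : ℝ, v = c • (P.generator (P.param σ (y, t)) : E) := by
  obtain ⟨⟨w, s⟩, rfl⟩ := hsurj v
  rw [hσ.mfderiv_proj_mfderiv_param hy] at hv
  have h := isInvertible_mfderivWithin_extChartAt_symm (I := 𝓡 (2 * n)) (hσ.subset_target hy)
  rw [ModelWithCorners.range_eq_univ, mfderivWithin_univ] at h
  have hw : w = 0 := h.injective (hv.trans (map_zero _).symm)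
  refine ⟨s, ?_⟩
  have hws : ((w, s) : EuclideanSpace ℝ (Fin (2 * n)) × ℝ) = s • (0, 1) := by simp [hw]
  rw [← hσ.mfderiv_param_snd hy t, hws]
  exact map_smul (mfderiv 𝓘(ℝ, EuclideanSpace ℝ (Fin (2 * n)) × ℝ) I (P.param σ) (y, t) :
    EuclideanSpace ℝ (Fin (2 * n)) × ℝ →L[ℝ] E) s (0, 1)

end PrincipalCircleBundle

end Geometry

/-! ### Invariant forms on `F × ℝ` -/

section Model

variable {F : Type*} [NormedAddCommGroup F] [NormedSpace ℝ F]

/-- The 1-form `U dt + γ` on `F × ℝ`, for a function `U` and a 1-form `γ` on `F`. -/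
def modelForm (U : F → ℝ) (γ : F → F →L[ℝ] ℝ) (p : F × ℝ) : F × ℝ →L[ℝ] ℝ :=
  U p.1 • ContinuousLinearMap.snd ℝ F ℝ + (γ p.1).comp (ContinuousLinearMap.fst ℝ F ℝ)

lemma modelForm_apply (U : F → ℝ) (γ : F → F →L[ℝ] ℝ) (p v : F × ℝ) :
    modelForm U γ p v = U p.1 * v.2 + γ p.1 v.1 := rfl

lemma hasFDerivAt_modelForm {U : F → ℝ} {γ : F → F →L[ℝ] ℝ} {p : F × ℝ}
    (hU : DifferentiableAt ℝ U p.1) (hγ : DifferentiableAt ℝ γ p.1) :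
    ∃ D : F × ℝ →L[ℝ] F × ℝ →L[ℝ] ℝ, HasFDerivAt (modelForm U γ) D p ∧ ∀ v w : F × ℝ,
      D v w = fderiv ℝ U p.1 v.1 * w.2 + fderiv ℝ γ p.1 v.1 w.1 := by
  have h1 : HasFDerivAt (fun p : F × ℝ ↦ U p.1)
      ((fderiv ℝ U p.1).comp (ContinuousLinearMap.fst ℝ F ℝ)) p :=
    hU.hasFDerivAt.comp p hasFDerivAt_fst
  have h2 : HasFDerivAt (fun p : F × ℝ ↦ γ p.1)
      ((fderiv ℝ γ p.1).comp (ContinuousLinearMap.fst ℝ F ℝ)) p :=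
    hγ.hasFDerivAt.comp p hasFDerivAt_fst
  have h3 := h1.smul_const (ContinuousLinearMap.snd ℝ F ℝ)
  have h4 := h2.clm_comp (hasFDerivAt_const (ContinuousLinearMap.fst ℝ F ℝ) p)
  exact ⟨_, h3.add h4, fun v w ↦ by simp⟩

lemma dForm_modelForm {U : F → ℝ} {γ : F → F →L[ℝ] ℝ} {p : F × ℝ}
    (hU : DifferentiableAt ℝ U p.1) (hγ : DifferentiableAt ℝ γ p.1) (v w : F × ℝ) :
    dForm (modelForm U γ) p v w =
      fderiv ℝ U p.1 v.1 * w.2 - fderiv ℝ U p.1 w.1 * v.2 + dForm γ p.1 v.1 w.1 := by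
  obtain ⟨D, hD, hDa⟩ := hasFDerivAt_modelForm hU hγ
  rw [dForm_apply, dForm_apply, hD.fderiv, hDa, hDa]
  ring

lemma dForm_congr {ψ ψ' : F → F →L[ℝ] ℝ} {y : F} (h : ψ =ᶠ[𝓝 y] ψ') : dForm ψ y = dForm ψ' y := by
  ext v w
  rw [dForm_apply, dForm_apply, h.fderiv_eq]

/-- If the kernels of two 1-forms `ψ`, `ψ'` agree near `p` and `ψ p = ψ' p`, then `dψ` and `dψ'`
agree on the kernel of `ψ p`. -/
lemma dForm_eq_of_ker {ψ ψ' : F → F →L[ℝ] ℝ} {p : F} (hψ : DifferentiableAt ℝ ψ p)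
    (hψ' : DifferentiableAt ℝ ψ' p) (hp : ψ p = ψ' p) (hne : ψ p ≠ 0)
    (hker : ∀ᶠ q in 𝓝 p, ∀ v, ψ' q v = 0 → ψ q v = 0) {x y : F} (hx : ψ p x = 0)
    (hy : ψ p y = 0) : dForm ψ p x y = dForm ψ' p x y := by
  obtain ⟨w, hw⟩ : ∃ w, ψ p w ≠ 0 := by
    by_contra! hcon
    exact hne (ContinuousLinearMap.ext hcon)
  have key : ∀ v v' : F, ψ p v' = 0 → fderiv ℝ ψ p v v' = fderiv ℝ ψ' p v v' := by
    intro v v' hv'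
    have he : (fun q ↦ ψ q w * ψ' q v') =ᶠ[𝓝 p] fun q ↦ ψ' q w * ψ q v' := by
      have hnz : ∀ᶠ q in 𝓝 p, ψ' q w ≠ 0 :=
        ((hψ'.clm_apply (differentiableAt_const w)).continuousAt).eventually_ne (by rwa [← hp])
      filter_upwards [hker, hnz] with q hq hqw
      have h0 := hq (v' - (ψ' q v' / ψ' q w) • w) (by simp [hqw])
      rw [map_sub, map_smul, smul_eq_mul, sub_eq_zero] at h0
      rw [h0]
      field_simp
    have hd : ∀ {χ : F → F →L[ℝ] ℝ} (u : F), DifferentiableAt ℝ χ p →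
        HasFDerivAt (fun q ↦ χ q u) ((fderiv ℝ χ p).flip u) p := by
      intro χ u hχ
      have := hχ.hasFDerivAt.clm_apply (hasFDerivAt_const u p)
      refine this.congr_fderiv ?_
      ext
      simp
    have h1 := ((hd w hψ).mul (hd v' hψ')).congr_of_eventuallyEq he.symm
    have h2 := (hd w hψ').mul (hd v' hψ)
    have h3 := DFunLike.congr_fun (h1.unique h2) v
    simp [← hp, hv'] at h3
    exact (h3.resolve_right hw).symm
  rw [dForm_apply, dForm_apply, key x y hy, key y x hx]

/-- The value of `a ∧ bⁿ` on the frame `(∂_t, ε₁, …, ε₂ₙ)` of `F × ℝ`. -/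
def frameVolume (n : ℕ) (ε : Fin (2 * n) → F) (a : F × ℝ → ℝ) (b : F × ℝ → F × ℝ → ℝ) : ℝ :=
  wedgePow n a b (Fin.cons ((0, 1) : F × ℝ) fun i ↦ (ε i, 0))

lemma frameVolume_modelForm_eq (n : ℕ) (ε : Fin (2 * n) → F) {U : F → ℝ} {β c : F → F →L[ℝ] ℝ}
    {y : F} (hU : DifferentiableAt ℝ U y) (hβ : DifferentiableAt ℝ β y)
    (hc : DifferentiableAt ℝ c y) (t : ℝ) {K : ℝ} (hK : K ≠ 0) :
    frameVolume n ε (modelForm U (c + K • β) (y, t))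
      (fun v w ↦ dForm (modelForm U (c + K • β)) (y, t) v w) =
    K ^ n * frameVolume n ε (modelForm U (β + K⁻¹ • c) (y, 0))
      (fun v w ↦ dForm (modelForm U (β + K⁻¹ • c)) (y, 0) v w) := by
  have h1 : DifferentiableAt ℝ (c + K • β) y := hc.add (hβ.const_smul K)
  have h2 : DifferentiableAt ℝ (β + K⁻¹ • c) y := hβ.add (hc.const_smul K⁻¹)
  have e1 : (⇑(modelForm U (c + K • β) (y, t)) : F × ℝ → ℝ) =
      fun v ↦ K * modelForm U (β + K⁻¹ • c) (y, 0) (v.1, K⁻¹ • v.2) := by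
    funext v
    simp [modelForm_apply]
    field_simp
    ring
  have e2 : (fun v w : F × ℝ ↦ dForm (modelForm U (c + K • β)) (y, t) v w) =
      fun v w ↦ K * dForm (modelForm U (β + K⁻¹ • c)) (y, 0) (v.1, K⁻¹ • v.2) (w.1, K⁻¹ • w.2) := by
    funext v w
    rw [dForm_modelForm hU h1, dForm_modelForm hU h2]
    simp only [dForm_apply]
    rw [fderiv_add hc (hβ.const_smul K), fderiv_const_smul hβ, fderiv_add hβ (hc.const_smul K⁻¹),
      fderiv_const_smul hc]
    simp
    field_simp
    ring
  unfold frameVolume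
  rw [e1, e2, wedgePow_scale n K (fun v : F × ℝ ↦ (v.1, K⁻¹ • v.2))
    (modelForm U (β + K⁻¹ • c) (y, 0)) (fun v w ↦ dForm (modelForm U (β + K⁻¹ • c)) (y, 0) v w)]
  have e4 : (fun i : Fin (2 * n + 1) ↦
      (((Fin.cons ((0, 1) : F × ℝ) fun i ↦ (ε i, 0) : Fin (2 * n + 1) → F × ℝ) i).1,
      K⁻¹ • ((Fin.cons ((0, 1) : F × ℝ) fun i ↦ (ε i, 0) : Fin (2 * n + 1) → F × ℝ) i).2)) =
      Fin.cons (K⁻¹ • ((0, 1) : F × ℝ)) fun i ↦ (ε i, 0) := by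
    funext i
    refine Fin.cases ?_ (fun j ↦ ?_) i <;> simp
  rw [e4]
  have := wedgePow_cons_smul n (modelForm U (β + K⁻¹ • c) (y, 0) : F × ℝ →ₗ[ℝ] ℝ)
    (dForm (modelForm U (β + K⁻¹ • c)) (y, 0)) K⁻¹ (0, 1) fun i ↦ (ε i, 0)
  simp only [ContinuousLinearMap.coe_coe] at this
  rw [this, pow_succ, mul_assoc, mul_inv_cancel_left₀ hK]

lemma exists_frameVolume_mul_pos (n : ℕ) (ε : Fin (2 * n) → F) {U : F → ℝ} {β c : F → F →L[ℝ] ℝ}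
    {O : Set F} (hO : IsOpen O) {y₀ : F} (hy₀ : y₀ ∈ O) (hU : ∀ y ∈ O, ContDiffAt ℝ 1 U y)
    (hβ : ∀ y ∈ O, ContDiffAt ℝ 1 β y) (hc : ∀ y ∈ O, ContDiffAt ℝ 1 c y)
    (hne : frameVolume n ε (modelForm U β (y₀, 0)) (fun v w ↦ dForm (modelForm U β) (y₀, 0) v w) ≠ 0) :
    ∃ K₀ : ℝ, ∀ᶠ y in 𝓝 y₀, ∀ K ≥ K₀, ∀ t : ℝ,
      0 < frameVolume n ε (modelForm U (c + K • β) (y, t))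
          (fun v w ↦ dForm (modelForm U (c + K • β)) (y, t) v w) *
        frameVolume n ε (modelForm U β (y, 0)) (fun v w ↦ dForm (modelForm U β) (y, 0) v w) := by
  let G : F × ℝ → ℝ := fun q ↦ frameVolume n ε (fun v ↦ U q.1 * v.2 + (β q.1 v.1 + q.2 * c q.1 v.1))
    fun v w ↦ fderiv ℝ U q.1 v.1 * w.2 - fderiv ℝ U q.1 w.1 * v.2 +
      ((fderiv ℝ β q.1 v.1 w.1 - fderiv ℝ β q.1 w.1 v.1) +
        q.2 * (fderiv ℝ c q.1 v.1 w.1 - fderiv ℝ c q.1 w.1 v.1))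
  have hG : ∀ y ∈ O, ∀ s : ℝ, frameVolume n ε (modelForm U (β + s • c) (y, 0))
      (fun v w ↦ dForm (modelForm U (β + s • c)) (y, 0) v w) = G (y, s) := by
    intro y hy s
    have hUd := (hU y hy).differentiableAt one_ne_zero
    have hβd := (hβ y hy).differentiableAt one_ne_zero
    have hcd := (hc y hy).differentiableAt one_ne_zero
    simp only [G]
    congr 1
    funext v w
    rw [dForm_modelForm hUd (hβd.add (hcd.const_smul s)), dForm_apply,
      fderiv_add hβd (hcd.const_smul s), fderiv_const_smul hcd]
    simp
    ring
  have hG0 : ∀ y ∈ O, frameVolume n ε (modelForm U β (y, 0))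
      (fun v w ↦ dForm (modelForm U β) (y, 0) v w) = G (y, 0) := by
    intro y hy
    rw [← hG y hy 0, zero_smul, add_zero]
  have hcont : ContinuousAt G (y₀, 0) := by
    have hU1 : ContinuousAt (fun q : F × ℝ ↦ U q.1) (y₀, 0) :=
      ContinuousAt.comp (hU y₀ hy₀).continuousAt continuousAt_fst
    have hβ1 : ContinuousAt (fun q : F × ℝ ↦ β q.1) (y₀, 0) :=
      ContinuousAt.comp (hβ y₀ hy₀).continuousAt continuousAt_fst
    have hc1 : ContinuousAt (fun q : F × ℝ ↦ c q.1) (y₀, 0) :=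
      ContinuousAt.comp (hc y₀ hy₀).continuousAt continuousAt_fst
    have hU2 : ContinuousAt (fun q : F × ℝ ↦ fderiv ℝ U q.1) (y₀, 0) :=
      ContinuousAt.comp ((hU y₀ hy₀).continuousAt_fderiv one_ne_zero) continuousAt_fst
    have hβ2 : ContinuousAt (fun q : F × ℝ ↦ fderiv ℝ β q.1) (y₀, 0) :=
      ContinuousAt.comp ((hβ y₀ hy₀).continuousAt_fderiv one_ne_zero) continuousAt_fst
    have hc2 : ContinuousAt (fun q : F × ℝ ↦ fderiv ℝ c q.1) (y₀, 0) :=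
      ContinuousAt.comp ((hc y₀ hy₀).continuousAt_fderiv one_ne_zero) continuousAt_fst
    refine continuousAt_wedgePow n (fun v ↦ ?_) (fun v w ↦ ?_) _ <;> fun_prop
  have hne' : G (y₀, 0) ≠ 0 := by rwa [← hG0 y₀ hy₀]
  have hpos : ∀ᶠ q in 𝓝 (y₀, (0 : ℝ)), 0 < G q * G (y₀, 0) :=
    (hcont.mul continuousAt_const).eventually (lt_mem_nhds (mul_self_pos.2 hne'))
  rw [nhds_prod_eq] at hpos
  obtain ⟨pa, hpa, pb, hpb, hp⟩ := Filter.eventually_prod_iff.1 hpos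
  obtain ⟨δ, hδ, hball⟩ := Metric.eventually_nhds_iff.1 hpb
  refine ⟨2 / δ, ?_⟩
  filter_upwards [hpa, hO.mem_nhds hy₀] with y hya hyO K hK t
  have hK0 : 0 < K := lt_of_lt_of_le (by positivity) hK
  have h1 : 0 < G (y, K⁻¹) * G (y₀, 0) := hp hya (hball (by
    rw [Real.dist_eq, sub_zero, abs_of_pos (by positivity), inv_lt_comm₀ hK0 hδ]
    refine lt_of_lt_of_le ?_ hK
    rw [inv_eq_one_div]
    gcongr
    norm_num))
  have h2 : 0 < G (y, 0) * G (y₀, 0) := hp hya (hball (by simpa using hδ))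
  rw [frameVolume_modelForm_eq n ε ((hU y hyO).differentiableAt one_ne_zero)
    ((hβ y hyO).differentiableAt one_ne_zero) ((hc y hyO).differentiableAt one_ne_zero) t hK0.ne',
    hG y hyO, hG0 y hyO]
  have h3 : 0 < G (y, K⁻¹) * G (y, 0) := by
    have : 0 < (G (y, K⁻¹) * G (y, 0)) * (G (y₀, 0)) ^ 2 := by
      calc (0 : ℝ) < (G (y, K⁻¹) * G (y₀, 0)) * (G (y, 0) * G (y₀, 0)) := mul_pos h1 h2
        _ = _ := by ring
    exact pos_of_mul_pos_left this (sq_nonneg _)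
  rw [mul_assoc]
  positivity

end Model

/-! ### Connection forms -/

/-- The real linear map `w ↦ Im (c̄ w)`. -/
def imConjMul (c : ℂ) : ℂ →L[ℝ] ℝ := c.re • Complex.imCLM - c.im • Complex.reCLM

lemma imConjMul_apply (c w : ℂ) : imConjMul c w = c.re * w.im - c.im * w.re := rfl

lemma imConjMul_circle_mul (z : Circle) (c w : ℂ) :
    imConjMul (z * c) (z * w) = imConjMul c w := by
  have hz : (z : ℂ).re * (z : ℂ).re + (z : ℂ).im * (z : ℂ).im = 1 := by
    rw [← Complex.normSq_apply, Circle.normSq_coe]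
  simp only [imConjMul_apply, Complex.mul_re, Complex.mul_im]
  linear_combination (c.re * w.im - c.im * w.re) * hz

lemma contDiff_imConjMul : ContDiff ℝ ∞ imConjMul :=
  (Complex.reCLM.contDiff.smul contDiff_const).sub (Complex.imCLM.contDiff.smul contDiff_const)

lemma contDiff_normSq : ContDiff ℝ ∞ Complex.normSq := by
  have h : (Complex.normSq : ℂ → ℝ) = fun z ↦ z.re * z.re + z.im * z.im := by
    funext z
    exact Complex.normSq_apply z
  rw [h]
  exact (Complex.reCLM.contDiff.mul Complex.reCLM.contDiff).add
    (Complex.imCLM.contDiff.mul Complex.imCLM.contDiff)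

section AngularForm

variable {F : Type*} [NormedAddCommGroup F] [NormedSpace ℝ F] {ι : Type*} (s : Finset ι)

/-- The 1-form `Im (∑ ḡᵢ dgᵢ) / ∑ |gᵢ|²`. -/
def angularForm (g : ι → F → ℂ) (y : F) : F →L[ℝ] ℝ :=
  (∑ i ∈ s, Complex.normSq (g i y))⁻¹ • ∑ i ∈ s, (imConjMul (g i y)).comp (fderiv ℝ (g i) y)

lemma contDiffAt_angularForm {g : ι → F → ℂ} {y : F} (hg : ∀ i, ContDiffAt ℝ ∞ (g i) y)
    (hpos : ∑ i ∈ s, Complex.normSq (g i y) ≠ 0) : ContDiffAt ℝ ∞ (angularForm s g) y := by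
  have hN : ContDiffAt ℝ ∞ (fun y ↦ ∑ i ∈ s, Complex.normSq (g i y)) y :=
    ContDiffAt.sum fun i _ ↦ contDiff_normSq.contDiffAt.comp y (hg i)
  refine (hN.inv hpos).smul (ContDiffAt.sum fun i _ ↦ ContDiffAt.clm_comp ?_ ?_)
  · exact contDiff_imConjMul.contDiffAt.comp y (hg i)
  · exact (hg i).fderiv_right (by norm_cast)

lemma angularForm_exp_mul {g : ι → F → ℂ} {p : F × ℝ} (hg : ∀ i, DifferentiableAt ℝ (g i) p.1)
    (hpos : ∑ i ∈ s, Complex.normSq (g i p.1) ≠ 0) :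
    angularForm s (fun i (p : F × ℝ) ↦ (Circle.exp p.2 : ℂ) * g i p.1) p =
      ContinuousLinearMap.snd ℝ F ℝ + (angularForm s g p.1).comp (ContinuousLinearMap.fst ℝ F ℝ) := by
  refine ContinuousLinearMap.ext fun v ↦ ?_
  have hE : HasFDerivAt (fun p : F × ℝ ↦ (Circle.exp p.2 : ℂ))
      ((ContinuousLinearMap.toSpanSingleton ℝ ((Circle.exp p.2 : ℂ) * Complex.I)).comp
        (ContinuousLinearMap.snd ℝ F ℝ)) p := by
    have h1 : HasDerivAt (fun t : ℝ ↦ (Circle.exp t : ℂ)) ((Circle.exp p.2 : ℂ) * Complex.I) p.2 := by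
      simp only [Circle.coe_exp]
      simpa using ((Complex.ofRealCLM.hasDerivAt (x := p.2)).mul_const Complex.I).cexp
    exact h1.hasFDerivAt.comp p hasFDerivAt_snd
  have hd : ∀ i, fderiv ℝ (fun p : F × ℝ ↦ (Circle.exp p.2 : ℂ) * g i p.1) p v =
      (Circle.exp p.2 : ℂ) * (fderiv ℝ (g i) p.1 v.1 + v.2 * Complex.I * g i p.1) := by
    intro i
    have h2 : HasFDerivAt (fun p : F × ℝ ↦ g i p.1)
        ((fderiv ℝ (g i) p.1).comp (ContinuousLinearMap.fst ℝ F ℝ)) p :=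
      (hg i).hasFDerivAt.comp p hasFDerivAt_fst
    rw [(hE.fun_mul h2).fderiv]
    simp
    ring
  have hterm : ∀ i, imConjMul (g i p.1) (fderiv ℝ (g i) p.1 v.1 + v.2 * Complex.I * g i p.1) =
      imConjMul (g i p.1) (fderiv ℝ (g i) p.1 v.1) + v.2 * Complex.normSq (g i p.1) := by
    intro i
    rw [map_add, imConjMul_apply (g i p.1) (v.2 * Complex.I * g i p.1), Complex.normSq_apply]
    simp
    ring
  simp only [angularForm, smul_apply, sum_apply,
    ContinuousLinearMap.comp_apply, add_apply, hd, imConjMul_circle_mul, hterm,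
    Complex.normSq_mul, Circle.normSq_coe, one_mul, ContinuousLinearMap.coe_snd',
    ContinuousLinearMap.coe_fst', Finset.sum_add_distrib, ← Finset.mul_sum, smul_eq_mul]
  field_simp
  ring

end AngularForm

section CombinedForm

variable {E : Type*} [NormedAddCommGroup E] [NormedSpace ℝ E] {H : Type*} [TopologicalSpace H]
  {I : ModelWithCorners ℝ E H} {M : Type*} [TopologicalSpace M] [ChartedSpace H M]
  {E' : Type*} [NormedAddCommGroup E'] [NormedSpace ℝ E'] {H' : Type*} [TopologicalSpace H']
  {I' : ModelWithCorners ℝ E' H'} {N : Type*} [TopologicalSpace N] [ChartedSpace H' N]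
  {F : Type*} [NormedAddCommGroup F] [NormedSpace ℝ F]
  {ι : Type*} (s : Finset ι) (h : ι → M → ℂ) (u : M → ℝ) (κ : M → N) (K : ℝ)

/-- The covector field `u A + K κ^*α` on `M`, where `A = Im (∑ h̄ᵢ dhᵢ) / ∑ |hᵢ|²`. -/
def combinedCovector (α : ∀ x : N, TangentSpace I' x →L[ℝ] ℝ) (x : M) : TangentSpace I x →L[ℝ] ℝ :=
  u x • ((∑ i ∈ s, Complex.normSq (h i x))⁻¹ •
    ∑ i ∈ s, (imConjMul (h i x)).comp (mfderiv I 𝓘(ℝ, ℂ) (h i) x : TangentSpace I x →L[ℝ] ℂ)) +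
  K • (α (κ x)).comp (mfderiv I I' κ x)

lemma combinedCovector_apply (α : ∀ x : N, TangentSpace I' x →L[ℝ] ℝ) (x : M) (w : E) :
    (combinedCovector (I := I) s h u κ K α x : E →L[ℝ] ℝ) w =
      u x * ((∑ i ∈ s, Complex.normSq (h i x))⁻¹ *
        ∑ i ∈ s, imConjMul (h i x) ((mfderiv I 𝓘(ℝ, ℂ) (h i) x : E →L[ℝ] ℂ) w)) +
      K * (α (κ x) : E' →L[ℝ] ℝ) ((mfderiv I I' κ x : E →L[ℝ] E') w) := by
  have hs : ∀ L : ι → E →L[ℝ] ℂ, (∑ i ∈ s, (imConjMul (h i x)).comp (L i)) w =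
      ∑ i ∈ s, imConjMul (h i x) (L i w) := by
    intro L
    rw [sum_apply]
    rfl
  exact congrArg (fun r : ℝ ↦ u x * ((∑ i ∈ s, Complex.normSq (h i x))⁻¹ * r) +
    K * (α (κ x) : E' →L[ℝ] ℝ) ((mfderiv I I' κ x : E →L[ℝ] E') w))
    (hs fun i ↦ (mfderiv I 𝓘(ℝ, ℂ) (h i) x : E →L[ℝ] ℂ))

lemma pullbackCovector_combined (α : ∀ x : N, TangentSpace I' x →L[ℝ] ℝ) {φ : F → M} {y : F}
    (hh : ∀ i, MDifferentiableAt I 𝓘(ℝ, ℂ) (h i) (φ y)) (hκ : MDifferentiableAt I I' κ (φ y))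
    (hφ : MDifferentiableAt 𝓘(ℝ, F) I φ y) :
    pullbackCovector (combinedCovector (I := I) s h u κ K α) φ y =
      u (φ y) • angularForm s (fun i y ↦ h i (φ y)) y +
        K • pullbackCovector α (fun y ↦ κ (φ y)) y := by
  have h1 : ∀ i, fderiv ℝ (fun y ↦ h i (φ y)) y =
      (mfderiv I 𝓘(ℝ, ℂ) (h i) (φ y) : E →L[ℝ] ℂ).comp (mfderiv 𝓘(ℝ, F) I φ y : F →L[ℝ] E) := by
    intro i
    rw [← mfderiv_eq_fderiv]
    exact mfderiv_comp y (hh i) hφ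
  have h2 : (mfderiv 𝓘(ℝ, F) I' (fun y ↦ κ (φ y)) y : F →L[ℝ] E') =
      (mfderiv I I' κ (φ y) : E →L[ℝ] E').comp (mfderiv 𝓘(ℝ, F) I φ y : F →L[ℝ] E) :=
    mfderiv_comp y hκ hφ
  refine ContinuousLinearMap.ext fun v ↦ ?_
  have e1 : pullbackCovector α (fun y ↦ κ (φ y)) y v =
      (α (κ (φ y)) : E' →L[ℝ] ℝ) ((mfderiv 𝓘(ℝ, F) I' (fun y ↦ κ (φ y)) y : F →L[ℝ] E') v) := rfl
  refine (combinedCovector_apply (E := E) (I := I) s h u κ K α (φ y)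
    ((mfderiv 𝓘(ℝ, F) I φ y : F →L[ℝ] E) v)).trans ?_
  rw [add_apply, smul_apply, smul_apply, e1, h2, angularForm, smul_apply, sum_apply]
  simp only [h1]
  rfl

lemma combinedCovector_comp (α : ∀ x : N, TangentSpace I' x →L[ℝ] ℝ) {f : M → M} {x : M}
    (hf : MDifferentiableAt I I f x) (hh : ∀ i, MDifferentiableAt I 𝓘(ℝ, ℂ) (h i) (f x))
    (hκ : MDifferentiableAt I I' κ (f x)) (hx : ∀ i, MDifferentiableAt I 𝓘(ℝ, ℂ) (h i) x)
    (z : Circle) (hu : u (f x) = u x) (hhf : ∀ i x, h i (f x) = z * h i x)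
    (hκf : κ ∘ f = κ) (v : E) :
    (combinedCovector (I := I) s h u κ K α (f x) : E →L[ℝ] ℝ) ((mfderiv I I f x : E →L[ℝ] E) v) =
      (combinedCovector (I := I) s h u κ K α x : E →L[ℝ] ℝ) v := by
  have h0 : ∀ x x', x = x' → (α x : E' →L[ℝ] ℝ) = α x' := by rintro x _ rfl; rfl
  let D : E →L[ℝ] E := mfderiv I I f x
  let L : ι → E →L[ℝ] ℂ := fun i ↦ mfderiv I 𝓘(ℝ, ℂ) (h i) x
  let L' : ι → E →L[ℝ] ℂ := fun i ↦ mfderiv I 𝓘(ℝ, ℂ) (h i) (f x)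
  let k : E →L[ℝ] E' := mfderiv I I' κ x
  let k' : E →L[ℝ] E' := mfderiv I I' κ (f x)
  have h1 : k' (D v) = k v := by
    have := mfderiv_comp x hκ hf
    rw [hκf] at this
    exact (DFunLike.congr_fun this v).symm
  have h2 : ∀ i, L' i (D v) = z * L i v := by
    intro i
    have h3 := mfderiv_comp x (hh i) hf
    have h4 : h i ∘ f = (fun w : ℂ ↦ (z : ℂ) * w) ∘ h i := funext fun x ↦ hhf i x
    have hz : HasFDerivAt (fun w : ℂ ↦ (z : ℂ) * w)
        ((z : ℂ) • ContinuousLinearMap.id ℝ ℂ) (h i x) :=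
      (hasFDerivAt_id (h i x)).const_mul (z : ℂ)
    have h5 := mfderiv_comp x hz.differentiableAt.mdifferentiableAt (hx i)
    rw [mfderiv_eq_fderiv, hz.fderiv] at h5
    rw [h4, h5] at h3
    exact (DFunLike.congr_fun h3 v).symm
  refine (combinedCovector_apply (E := E) (I := I) s h u κ K α (f x) (D v)).trans
    (Eq.trans ?_ (combinedCovector_apply (E := E) (I := I) s h u κ K α x v).symm)
  change u (f x) * ((∑ i ∈ s, Complex.normSq (h i (f x)))⁻¹ *
      ∑ i ∈ s, imConjMul (h i (f x)) (L' i (D v))) + K * (α (κ (f x)) : E' →L[ℝ] ℝ) (k' (D v)) =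
    u x * ((∑ i ∈ s, Complex.normSq (h i x))⁻¹ * ∑ i ∈ s, imConjMul (h i x) (L i v)) +
      K * (α (κ x) : E' →L[ℝ] ℝ) (k v)
  rw [h1, hu, h0 (κ (f x)) (κ x) (congrFun hκf x)]
  simp only [h2, hhf, imConjMul_circle_mul, Complex.normSq_mul, Circle.normSq_coe, one_mul]
  rfl

variable [IsManifold I ∞ M] [I.Boundaryless] [IsManifold I' ∞ N] [I'.Boundaryless]

/-- The smooth 1-form `u A + K κ^*α` on `M`, where `A = Im (∑ h̄ᵢ dhᵢ) / ∑ |hᵢ|²`. -/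
def combinedForm (α : OneForm I' N) (hh : ∀ i, ContMDiff I 𝓘(ℝ, ℂ) ∞ (h i))
    (hpos : ∀ x, ∑ i ∈ s, Complex.normSq (h i x) ≠ 0) (hu : ContMDiff I 𝓘(ℝ, ℝ) ∞ u)
    (hκ : ContMDiff I I' ∞ κ) : OneForm I M where
  toFun := combinedCovector s h u κ K α.toFun
  smooth := by
    intro x₀
    rw [contMDiffAt_covector_iff]
    have hφ : ∀ y ∈ (extChartAt I x₀).target,
        ContMDiffAt 𝓘(ℝ, E) I ∞ (extChartAt I x₀).symm y := fun y hy ↦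
      (contMDiffOn_extChartAt_symm x₀).contMDiffAt (extChartAt_target_mem_nhds' hy)
    have hy₀ := mem_extChartAt_target (I := I) x₀
    have hev : pullbackCovector (combinedCovector (I := I) s h u κ K α.toFun) (extChartAt I x₀).symm
        =ᶠ[𝓝 (extChartAt I x₀ x₀)] fun y ↦ u ((extChartAt I x₀).symm y) •
          angularForm s (fun i y ↦ h i ((extChartAt I x₀).symm y)) y +
            K • pullbackCovector α.toFun (fun y ↦ κ ((extChartAt I x₀).symm y)) y := by
      filter_upwards [extChartAt_target_mem_nhds (I := I) x₀] with y hy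
      exact pullbackCovector_combined s h u κ K α.toFun
        (fun i ↦ (hh i).mdifferentiableAt (by decide)) (hκ.mdifferentiableAt (by decide))
        ((hφ y hy).mdifferentiableAt (by decide))
    refine ContDiffAt.congr_of_eventuallyEq ?_ hev
    have h1 : ContDiffAt ℝ ∞ (fun y ↦ u ((extChartAt I x₀).symm y)) (extChartAt I x₀ x₀) :=
      (hu.contMDiffAt.comp _ (hφ _ hy₀)).contDiffAt
    have h2 : ContDiffAt ℝ ∞ (angularForm s (fun i y ↦ h i ((extChartAt I x₀).symm y)))
        (extChartAt I x₀ x₀) :=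
      contDiffAt_angularForm s (fun i ↦ ((hh i).contMDiffAt.comp _ (hφ _ hy₀)).contDiffAt) (hpos _)
    have h3 := α.contDiffAt_pullback (φ := fun y ↦ κ ((extChartAt I x₀).symm y))
      (hκ.contMDiffAt.comp _ (hφ _ hy₀))
    exact (h1.smul h2).add (h3.const_smul K)

end CombinedForm

section Equivariant

variable {n : ℕ} {B : Type*} [TopologicalSpace B]
  [ChartedSpace (EuclideanSpace ℝ (Fin (2 * n))) B] [IsManifold (𝓡 (2 * n)) ∞ B] [T2Space B]
  {E : Type*} [NormedAddCommGroup E] [NormedSpace ℝ E]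
  {H : Type*} [TopologicalSpace H] {I : ModelWithCorners ℝ E H}
  {M : Type*} [TopologicalSpace M] [ChartedSpace H M]
  (P : PrincipalCircleBundle (𝓡 (2 * n)) B I M)

lemma PrincipalCircleBundle.exists_equivariant (b₀ : B) :
    ∃ h : M → ℂ, ContMDiff I 𝓘(ℝ, ℂ) ∞ h ∧ (∀ z x, h (P.act z x) = z * h x) ∧
      ∀ᶠ b in 𝓝 b₀, ∀ x, P.proj x = b → h x ≠ 0 := by
  obtain ⟨e, hb, hes, -, he⟩ := P.exists_trivialization b₀
  obtain ⟨f, hf⟩ := ((SmoothBumpFunction.nhds_basis_support (I := 𝓡 (2 * n))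
    (e.open_baseSet.mem_nhds hb)).ex_mem)
  have hzero : ∀ x, x ∉ e.source → f (P.proj x) = 0 := fun x hx ↦ by
    by_contra hne
    exact hx (e.mem_source.2 (hf (subset_tsupport _ hne)))
  refine ⟨fun x ↦ (f (P.proj x) : ℝ) • (((e x).2 : Circle) : ℂ), fun x ↦ ?_, fun z x ↦ ?_, ?_⟩
  · by_cases hx : P.proj x ∈ tsupport f
    · have hxs : x ∈ e.source := e.mem_source.2 (hf hx)
      have h1 : ContMDiffAt I 𝓘(ℝ, ℝ) ∞ (fun x ↦ f (P.proj x)) x :=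
        f.contMDiff.contMDiffAt.comp x P.smooth_proj.contMDiffAt
      have h2 : ContMDiffAt I 𝓘(ℝ, ℂ) ∞ (fun x ↦ (((e x).2 : Circle) : ℂ)) x :=
        contMDiff_circle_coe.contMDiffAt.comp x
          (contMDiff_snd.contMDiffAt.comp x (hes.contMDiffAt (e.open_source.mem_nhds hxs)))
      exact h1.smul h2
    · have hev : (fun x ↦ (f (P.proj x) : ℝ) • (((e x).2 : Circle) : ℂ)) =ᶠ[𝓝 x] fun _ ↦ 0 := by
        filter_upwards [P.smooth_proj.continuous.continuousAt
          ((isClosed_tsupport f).isOpen_compl.mem_nhds hx)] with x' hx'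
        rw [image_eq_zero_of_notMem_tsupport hx', zero_smul]
      exact contMDiffAt_const.congr_of_eventuallyEq hev
  · by_cases hx : x ∈ e.source
    · simp only [P.proj_act, he z x hx, Circle.coe_mul]
      rw [mul_smul_comm]
    · simp only [P.proj_act, hzero x hx, zero_smul, mul_zero]
  · filter_upwards [f.eventuallyEq_one] with b hb x hx
    rw [hx, hb]
    simp

lemma PrincipalCircleBundle.exists_equivariant_family [CompactSpace B] :
    ∃ (s : Finset B) (h : B → M → ℂ), (∀ i, ContMDiff I 𝓘(ℝ, ℂ) ∞ (h i)) ∧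
      (∀ i z x, h i (P.act z x) = z * h i x) ∧ ∀ x, 0 < ∑ i ∈ s, Complex.normSq (h i x) := by
  choose h hsm heq hne using P.exists_equivariant
  obtain ⟨s, hs⟩ := CompactSpace.elim_nhds_subcover _ hne
  refine ⟨s, h, hsm, heq, fun x ↦ ?_⟩
  have hx : P.proj x ∈ (⊤ : Set B) := trivial
  rw [← hs] at hx
  obtain ⟨i, hi, hix⟩ := Set.mem_iUnion₂.1 hx
  exact Finset.sum_pos' (fun j _ ↦ Complex.normSq_nonneg _)
    ⟨i, hi, Complex.normSq_pos.2 (hix x rfl)⟩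

end Equivariant

/-! ### Contact volumes in local parametrizations -/

section PullbackComp

variable {E : Type*} [NormedAddCommGroup E] [NormedSpace ℝ E] {H : Type*} [TopologicalSpace H]
  {I : ModelWithCorners ℝ E H} {M : Type*} [TopologicalSpace M] [ChartedSpace H M]
  {F G : Type*} [NormedAddCommGroup F] [NormedSpace ℝ F] [NormedAddCommGroup G] [NormedSpace ℝ G]

lemma pullbackCovector_comp (α : ∀ x : M, TangentSpace I x →L[ℝ] ℝ) {φ : F → M} {g : G → F} {y : G}
    (hφ : MDifferentiableAt 𝓘(ℝ, F) I φ (g y)) (hg : DifferentiableAt ℝ g y) :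
    pullbackCovector α (φ ∘ g) y = (pullbackCovector α φ (g y)).comp (fderiv ℝ g y) := by
  have h1 : (mfderiv 𝓘(ℝ, G) I (φ ∘ g) y : G →L[ℝ] E) =
      (mfderiv 𝓘(ℝ, F) I φ (g y) : F →L[ℝ] E).comp (fderiv ℝ g y) := by
    have h := mfderiv_comp y hφ hg.mdifferentiableAt
    rwa [mfderiv_eq_fderiv] at h
  refine ContinuousLinearMap.ext fun v ↦ ?_
  exact congrArg (α (φ (g y)) : E →L[ℝ] ℝ) (DFunLike.congr_fun h1 v)

lemma pullbackCovector_congr (α : ∀ x : M, TangentSpace I x →L[ℝ] ℝ) {φ φ' : F → M} {y : F}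
    (h : φ =ᶠ[𝓝 y] φ') : pullbackCovector α φ y = pullbackCovector α φ' y := by
  have h0 : ∀ x x', x = x' → (α x : E →L[ℝ] ℝ) = α x' := by rintro x _ rfl; rfl
  have h1 : (mfderiv 𝓘(ℝ, F) I φ y : F →L[ℝ] E) = mfderiv 𝓘(ℝ, F) I φ' y := h.mfderiv_eq
  refine ContinuousLinearMap.ext fun v ↦ ?_
  change (α (φ y) : E →L[ℝ] ℝ) ((mfderiv 𝓘(ℝ, F) I φ y : F →L[ℝ] E) v) =
    (α (φ' y) : E →L[ℝ] ℝ) ((mfderiv 𝓘(ℝ, F) I φ' y : F →L[ℝ] E) v)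
  rw [h1, h0 _ _ h.self_of_nhds]
  rfl

end PullbackComp

section Local

variable {n : ℕ} {B : Type*} [TopologicalSpace B]
  [ChartedSpace (EuclideanSpace ℝ (Fin (2 * n))) B]
  {E : Type*} [NormedAddCommGroup E] [NormedSpace ℝ E]
  {H : Type*} [TopologicalSpace H] {I : ModelWithCorners ℝ E H}
  {M : Type*} [TopologicalSpace M] [ChartedSpace H M]
  {P : PrincipalCircleBundle (𝓡 (2 * n)) B I M} {b₀ : B}
  {O : Set (EuclideanSpace ℝ (Fin (2 * n)))} {σ : EuclideanSpace ℝ (Fin (2 * n)) → M}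

/-- The function `α(∂_θ)`. -/
def PrincipalCircleBundle.generatorValue (P : PrincipalCircleBundle (𝓡 (2 * n)) B I M)
    (α : ∀ x : M, TangentSpace I x →L[ℝ] ℝ) (x : M) : ℝ :=
  α x (P.generator x)

namespace PrincipalCircleBundle.IsLocalSection

/-- The standard frame `(∂_t, ε₁, …, ε₂ₙ)` in a local parametrization. -/
def frame (P : PrincipalCircleBundle (𝓡 (2 * n)) B I M) (σ : EuclideanSpace ℝ (Fin (2 * n)) → M)
    (p : EuclideanSpace ℝ (Fin (2 * n)) × ℝ) (i : Fin (2 * n)) : TangentSpace I (P.param σ p) :=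
  (mfderiv 𝓘(ℝ, EuclideanSpace ℝ (Fin (2 * n)) × ℝ) I (P.param σ) p : _ →L[ℝ] E)
    ((EuclideanSpace.basisFun (Fin (2 * n)) ℝ i, 0) : EuclideanSpace ℝ (Fin (2 * n)) × ℝ)

lemma contactVolume_frame [IsManifold I ∞ M] [I.Boundaryless] (hσ : P.IsLocalSection b₀ O σ)
    (α : OneForm I M) {y : EuclideanSpace ℝ (Fin (2 * n))} (hy : y ∈ O) (t : ℝ) :
    α.contactVolume n (P.param σ (y, t))
        (Fin.cons (P.generator (P.param σ (y, t))) (frame P σ (y, t))) =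
      frameVolume n (EuclideanSpace.basisFun (Fin (2 * n)) ℝ)
        (pullbackCovector α.toFun (P.param σ) (y, t))
        (fun v w ↦ dForm (pullbackCovector α.toFun (P.param σ)) (y, t) v w) := by
  rw [frameVolume, ← α.contactVolume_pullback n (hσ.contMDiffAt_param hy t)]
  congr 1
  funext i
  refine Fin.cases ?_ (fun j ↦ ?_) i
  · exact (hσ.mfderiv_param_snd hy t).symm
  · rfl

lemma pullback_param_add (hσ : P.IsLocalSection b₀ O σ) (α : ∀ x : M, TangentSpace I x →L[ℝ] ℝ)
    {y : EuclideanSpace ℝ (Fin (2 * n))} (hy : y ∈ O) (t : ℝ)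
    (v : EuclideanSpace ℝ (Fin (2 * n)) × ℝ) :
    pullbackCovector α (P.param σ) (y, t) v =
      (α (P.act (Circle.exp t) (P.param σ (y, 0))) : E →L[ℝ] ℝ)
        ((mfderiv I I (P.act (Circle.exp t)) (P.param σ (y, 0)) : E →L[ℝ] E)
          ((mfderiv 𝓘(ℝ, EuclideanSpace ℝ (Fin (2 * n)) × ℝ) I (P.param σ) (y, 0) : _ →L[ℝ] E) v)) := by
  have hg : HasFDerivAt (fun p : EuclideanSpace ℝ (Fin (2 * n)) × ℝ ↦ (p.1, p.2 + t))
      (ContinuousLinearMap.id ℝ _) (y, 0) := by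
    refine (hasFDerivAt_fst.prodMk (hasFDerivAt_snd.add_const t)).congr_fderiv ?_
    ext <;> simp
  have hc : P.param σ ∘ (fun p : EuclideanSpace ℝ (Fin (2 * n)) × ℝ ↦ (p.1, p.2 + t)) =
      P.act (Circle.exp t) ∘ P.param σ := by
    funext p
    simp only [Function.comp_apply, param, ← P.mul_act, Circle.exp_add, mul_comm]
  have h0 : ((y, 0 + t) : EuclideanSpace ℝ (Fin (2 * n)) × ℝ) = (y, t) := by rw [zero_add]
  have h1 := pullbackCovector_comp α (φ := P.param σ)
    (g := fun p : EuclideanSpace ℝ (Fin (2 * n)) × ℝ ↦ (p.1, p.2 + t)) (y := (y, 0))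
    (h0 ▸ hσ.mdifferentiableAt_param hy t :
      MDifferentiableAt 𝓘(ℝ, EuclideanSpace ℝ (Fin (2 * n)) × ℝ) I (P.param σ) (y, 0 + t))
    hg.differentiableAt
  rw [hg.fderiv, hc, ContinuousLinearMap.comp_id, h0] at h1
  rw [← h1]
  exact congrArg (α (P.act (Circle.exp t) (P.param σ (y, 0))) : E →L[ℝ] ℝ)
    (DFunLike.congr_fun (mfderiv_comp (y, (0 : ℝ)) (P.mdifferentiableAt_act _ _)
      (hσ.mdifferentiableAt_param hy 0)) v)

lemma pullback_param_zero (hσ : P.IsLocalSection b₀ O σ) (α : ∀ x : M, TangentSpace I x →L[ℝ] ℝ)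
    {y : EuclideanSpace ℝ (Fin (2 * n))} (hy : y ∈ O) (t : ℝ) :
    pullbackCovector α (P.param σ) (y, 0) =
      modelForm (fun y ↦ P.generatorValue α (σ y)) (pullbackCovector α σ) (y, t) := by
  have h0 : ∀ y, P.param σ (y, 0) = σ y := fun y ↦ by
    rw [param, Circle.exp_zero, P.one_act]
  have hg : HasFDerivAt (fun y : EuclideanSpace ℝ (Fin (2 * n)) ↦ (y, (0 : ℝ)))
      (ContinuousLinearMap.inl ℝ _ ℝ) y := hasFDerivAt_prodMk_left y 0
  have hc : P.param σ ∘ (fun y ↦ (y, (0 : ℝ))) = σ := funext h0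
  have h1 := pullbackCovector_comp α
    (g := fun y : EuclideanSpace ℝ (Fin (2 * n)) ↦ (y, (0 : ℝ))) (y := y)
    (hσ.mdifferentiableAt_param hy 0) hg.differentiableAt
  rw [hg.fderiv, hc] at h1
  refine ContinuousLinearMap.ext fun v ↦ ?_
  have hv : v = (v.1, 0) + v.2 • (0, 1) := by ext <;> simp
  have h2 : pullbackCovector α (P.param σ) (y, 0) (0, 1) = P.generatorValue α (σ y) := by
    rw [← h0 y]
    exact congrArg (α (P.param σ (y, 0)) : E →L[ℝ] ℝ) (hσ.mfderiv_param_snd hy 0)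
  rw [modelForm_apply, h1]
  conv_lhs => rw [hv]
  rw [map_add, map_smul, h2]
  simp
  ring

lemma contDiffAt_generatorValue [IsManifold I ∞ M] [I.Boundaryless] (hσ : P.IsLocalSection b₀ O σ)
    (α : OneForm I M) {y : EuclideanSpace ℝ (Fin (2 * n))} (hy : y ∈ O) :
    ContDiffAt ℝ ∞ (fun y ↦ P.generatorValue α.toFun (σ y)) y := by
  have h1 : ContDiffAt ℝ ∞ (fun y ↦ pullbackCovector α.toFun (P.param σ) (y, 0) (0, 1)) y :=
    (ContDiffAt.comp (f := fun y : EuclideanSpace ℝ (Fin (2 * n)) ↦ (y, (0 : ℝ))) y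
      (α.contDiffAt_pullback (hσ.contMDiffAt_param hy 0))
      (contDiffAt_id.prodMk contDiffAt_const)).clm_apply contDiffAt_const
  refine h1.congr_of_eventuallyEq ?_
  filter_upwards [hσ.mem_nhds hy] with z hz
  rw [hσ.pullback_param_zero α.toFun hz 0, modelForm_apply]
  simp

/-- For an invariant contact structure, the contact volume can be computed from the
invariant form `U dt + β` determined by the restriction of the contact form to a local section. -/
lemma contactVolume_invariant [IsManifold (𝓡 (2 * n)) ∞ B] [IsManifold I ∞ M] [I.Boundaryless]
    (hσ : P.IsLocalSection b₀ O σ)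
    (α : OneForm I M)
    (hinv : ∀ (z : Circle) (x : M) (v : E), (α.toFun x : E →L[ℝ] ℝ) v = 0 →
      (α.toFun (P.act z x) : E →L[ℝ] ℝ) ((mfderiv I I (P.act z) x : E →L[ℝ] E) v) = 0)
    {y : EuclideanSpace ℝ (Fin (2 * n))} (hy : y ∈ O) :
    α.contactVolume n (P.param σ (y, 0))
        (Fin.cons (P.generator (P.param σ (y, 0))) (frame P σ (y, 0))) =
      frameVolume n (EuclideanSpace.basisFun (Fin (2 * n)) ℝ)
        (modelForm (fun y ↦ P.generatorValue α.toFun (σ y)) (pullbackCovector α.toFun σ) (y, 0))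
        (fun v w ↦ dForm (modelForm (fun y ↦ P.generatorValue α.toFun (σ y))
          (pullbackCovector α.toFun σ)) (y, 0) v w) := by
  rw [hσ.contactVolume_frame α hy 0]
  set ψ := pullbackCovector α.toFun (P.param σ)
  set ψ' := modelForm (fun y ↦ P.generatorValue α.toFun (σ y)) (pullbackCovector α.toFun σ)
  have heq : ψ (y, 0) = ψ' (y, 0) := hσ.pullback_param_zero α.toFun hy 0
  have hψ : DifferentiableAt ℝ ψ (y, 0) :=
    (α.contDiffAt_pullback (hσ.contMDiffAt_param hy 0)).differentiableAt (by decide)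
  have hψ' : DifferentiableAt ℝ ψ' (y, 0) := by
    obtain ⟨D, hD, -⟩ := hasFDerivAt_modelForm (p := (y, (0 : ℝ)))
      ((hσ.contDiffAt_generatorValue α hy).differentiableAt (by decide))
      ((α.contDiffAt_pullback (hσ.smooth y hy)).differentiableAt (by decide))
    exact hD.differentiableAt
  have hker : ∀ᶠ q in 𝓝 (y, (0 : ℝ)), ∀ v, ψ' q v = 0 → ψ q v = 0 := by
    filter_upwards [continuousAt_fst (p := (y, (0 : ℝ))) (hσ.mem_nhds hy)] with q hq v hv
    obtain ⟨y', t⟩ := q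
    have h1 : ψ' (y', t) = ψ (y', 0) := (hσ.pullback_param_zero α.toFun hq t).symm
    rw [h1] at hv
    exact (hσ.pullback_param_add α.toFun hq t v).trans (hinv _ _ _ hv)
  rw [frameVolume, frameVolume, ← heq]
  by_cases hne : ψ (y, 0) = 0
  · rw [hne]
    simp [wedgePow]
  · exact wedgePow_congr_of_ker (by simp [Module.finrank_prod])
      (ψ (y, 0) : EuclideanSpace ℝ (Fin (2 * n)) × ℝ →ₗ[ℝ] ℝ) _ _
      (fun v w hv hw ↦ dForm_eq_of_ker hψ hψ' heq hne hker hv hw) _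

end PrincipalCircleBundle.IsLocalSection

end Local

/-! ### Transfer of invariant contact structures from the trivial bundle -/

section Invariant

variable {n : ℕ} {B : Type*} [TopologicalSpace B]
  [ChartedSpace (EuclideanSpace ℝ (Fin (2 * n))) B] [IsManifold (𝓡 (2 * n)) ∞ B]
  {E : Type*} [NormedAddCommGroup E] [NormedSpace ℝ E]
  {H : Type*} [TopologicalSpace H] {I : ModelWithCorners ℝ E H}
  {M : Type*} [TopologicalSpace M] [ChartedSpace H M] [IsManifold I ∞ M]
  {P : PrincipalCircleBundle (𝓡 (2 * n)) B I M} {o : ManifoldOrientation (2 * n) B}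

lemma InvariantContactStructure.form_act_eq_zero (ξ : InvariantContactStructure P o)
    {α : OneForm I M} (hα : ∀ x, ξ.plane x = LinearMap.ker (α.toFun x : TangentSpace I x →ₗ[ℝ] ℝ))
    (z : Circle) (x : M) (v : E) (hv : (α.toFun x : E →L[ℝ] ℝ) v = 0) :
    (α.toFun (P.act z x) : E →L[ℝ] ℝ) ((mfderiv I I (P.act z) x : E →L[ℝ] E) v) = 0 := by
  have h1 : (v : TangentSpace I x) ∈ ξ.plane x := by
    rw [hα]
    exact hv
  have h2 := Submodule.mem_map_of_mem
    (f := (mfderiv I I (P.act z) x : TangentSpace I x →ₗ[ℝ] TangentSpace I (P.act z x))) h1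
  rw [ξ.invariant, hα] at h2
  exact h2

omit [IsManifold (𝓡 (2 * n)) ∞ B] in
lemma generatorValue_act_eq_zero {α : OneForm I M}
    (hinv : ∀ (z : Circle) (x : M) (v : E), (α.toFun x : E →L[ℝ] ℝ) v = 0 →
      (α.toFun (P.act z x) : E →L[ℝ] ℝ) ((mfderiv I I (P.act z) x : E →L[ℝ] E) v) = 0)
    (z : Circle) {x : M} (hx : P.generatorValue α.toFun x = 0) :
    P.generatorValue α.toFun (P.act z x) = 0 :=
  (congrArg (α.toFun (P.act z x) : E →L[ℝ] ℝ) (P.mfderiv_act_generator z x)).symm.trans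
    (hinv z x _ hx)

end Invariant

section Transfer

variable {n : ℕ} {B : Type*} [TopologicalSpace B]
  [ChartedSpace (EuclideanSpace ℝ (Fin (2 * n))) B] [IsManifold (𝓡 (2 * n)) ∞ B]

lemma trivialCircleBundle_isLocalSection (b₀ : B) :
    (trivialCircleBundle (𝓡 (2 * n)) B).IsLocalSection b₀ (extChartAt (𝓡 (2 * n)) b₀).target
      fun y ↦ ((extChartAt (𝓡 (2 * n)) b₀).symm y, (1 : Circle)) where
  isOpen := isOpen_extChartAt_target b₀
  mem := mem_extChartAt_target b₀
  subset_target := subset_rfl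
  smooth _ hy := ((contMDiffOn_extChartAt_symm b₀).contMDiffAt
    (extChartAt_target_mem_nhds' hy)).prodMk contMDiffAt_const
  proj_eq _ _ := rfl

/-- The function `α(∂_θ)` on `B × {1}`. -/
def unitSectionValue (α : OneForm ((𝓡 (2 * n)).prod (𝓡 1)) (B × Circle)) (b : B) : ℝ :=
  (trivialCircleBundle (𝓡 (2 * n)) B).generatorValue α.toFun (b, 1)

lemma contMDiff_unitSectionValue (α : OneForm ((𝓡 (2 * n)).prod (𝓡 1)) (B × Circle)) :
    ContMDiff (𝓡 (2 * n)) 𝓘(ℝ, ℝ) ∞ (unitSectionValue α) := by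
  intro b₀
  rw [contMDiffAt_iff_source, ModelWithCorners.range_eq_univ, contMDiffWithinAt_univ]
  exact ((trivialCircleBundle_isLocalSection b₀).contDiffAt_generatorValue α
    (mem_extChartAt_target b₀)).contMDiffAt

variable {E : Type*} [NormedAddCommGroup E] [NormedSpace ℝ E]
  {H : Type*} [TopologicalSpace H] {I : ModelWithCorners ℝ E H}
  {M : Type*} [TopologicalSpace M] [ChartedSpace H M] [IsManifold I ∞ M] [I.Boundaryless]
  (P : PrincipalCircleBundle (𝓡 (2 * n)) B I M)
  (α : OneForm ((𝓡 (2 * n)).prod (𝓡 1)) (B × Circle))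
  {ι : Type*} (s : Finset ι) (h : ι → M → ℂ) (hh : ∀ i, ContMDiff I 𝓘(ℝ, ℂ) ∞ (h i))
  (hpos : ∀ x, ∑ i ∈ s, Complex.normSq (h i x) ≠ 0) (K : ℝ)

/-- The form `u A + K β`, where the invariant contact form on the trivial bundle restricts to
`u dθ + β` along `B × {1}` and `A` is a connection form of `P`. -/
def transferForm : OneForm I M :=
  combinedForm s h (fun x ↦ unitSectionValue α (P.proj x)) (fun x ↦ (P.proj x, (1 : Circle))) K α hh
    hpos ((contMDiff_unitSectionValue α).comp P.smooth_proj) (P.smooth_proj.prodMk contMDiff_const)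

lemma transferForm_act (heq : ∀ i z x, h i (P.act z x) = z * h i x) (z : Circle) (x : M) (v : E) :
    ((transferForm P α s h hh hpos K).toFun (P.act z x) : E →L[ℝ] ℝ)
      ((mfderiv I I (P.act z) x : E →L[ℝ] E) v) =
    ((transferForm P α s h hh hpos K).toFun x : E →L[ℝ] ℝ) v :=
  combinedCovector_comp s h _ _ K α.toFun (P.mdifferentiableAt_act z x)
    (fun i ↦ (hh i).mdifferentiableAt (by decide))
    ((P.smooth_proj.prodMk contMDiff_const).mdifferentiableAt (by decide))
    (fun i ↦ (hh i).mdifferentiableAt (by decide)) z (by rw [P.proj_act])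
    (fun i x ↦ heq i z x) (funext fun x ↦ by simp only [Function.comp_apply, P.proj_act]) v

variable {b₀ : B} {O : Set (EuclideanSpace ℝ (Fin (2 * n)))}
  {σ : EuclideanSpace ℝ (Fin (2 * n)) → M}

variable (b₀) in
/-- The 1-form `β` in the chart at `b₀`, where `α` restricts to `u dθ + β` along `B × {1}`. -/
def unitSectionForm : EuclideanSpace ℝ (Fin (2 * n)) → EuclideanSpace ℝ (Fin (2 * n)) →L[ℝ] ℝ :=
  pullbackCovector α.toFun fun y ↦ ((extChartAt (𝓡 (2 * n)) b₀).symm y, (1 : Circle))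

lemma pullback_transferForm (hσ : P.IsLocalSection b₀ O σ)
    (heq : ∀ i z x, h i (P.act z x) = z * h i x) {y : EuclideanSpace ℝ (Fin (2 * n))} (hy : y ∈ O)
    (t : ℝ) :
    pullbackCovector (transferForm P α s h hh hpos K).toFun (P.param σ) (y, t) =
      modelForm (fun y ↦ unitSectionValue α ((extChartAt (𝓡 (2 * n)) b₀).symm y))
        ((fun y ↦ unitSectionValue α ((extChartAt (𝓡 (2 * n)) b₀).symm y) •
          angularForm s (fun i y ↦ h i (σ y)) y) + K • unitSectionForm α b₀) (y, t) := by
  have h1 := pullbackCovector_combined (I := I) s h (fun x ↦ unitSectionValue α (P.proj x))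
    (fun x ↦ (P.proj x, (1 : Circle))) K α.toFun (φ := P.param σ) (y := (y, t))
    (fun i ↦ (hh i).mdifferentiableAt (by decide))
    ((P.smooth_proj.prodMk contMDiff_const).mdifferentiableAt (by decide))
    (hσ.mdifferentiableAt_param hy t)
  have h2 : (fun i (p : EuclideanSpace ℝ (Fin (2 * n)) × ℝ) ↦ h i (P.param σ p)) =
      fun i p ↦ (Circle.exp p.2 : ℂ) * h i (σ p.1) := by
    funext i p
    exact heq i _ _
  have hσy : ∀ i, DifferentiableAt ℝ (fun y ↦ h i (σ y)) y := fun i ↦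
    ((hh i).contMDiffAt.comp y (hσ.smooth y hy)).contDiffAt.differentiableAt (by decide)
  have h3 : pullbackCovector α.toFun (fun p ↦ (P.proj (P.param σ p), (1 : Circle))) (y, t) =
      (unitSectionForm α b₀ y).comp (ContinuousLinearMap.fst ℝ _ ℝ) := by
    have hev : (fun p ↦ (P.proj (P.param σ p), (1 : Circle))) =ᶠ[𝓝 (y, t)]
        (fun y ↦ ((extChartAt (𝓡 (2 * n)) b₀).symm y, (1 : Circle))) ∘
          (Prod.fst : EuclideanSpace ℝ (Fin (2 * n)) × ℝ → EuclideanSpace ℝ (Fin (2 * n))) := by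
      filter_upwards [continuousAt_fst (p := (y, t)) (hσ.mem_nhds hy)] with p hp
      simp only [Function.comp_apply]
      rw [← hσ.proj_param hp p.2]
    rw [pullbackCovector_congr _ hev, pullbackCovector_comp α.toFun
      (((trivialCircleBundle_isLocalSection b₀).smooth y (hσ.subset_target hy)).mdifferentiableAt
        (by decide)) differentiableAt_fst, fderiv_fst]
    rfl
  have hσx : ∑ i ∈ s, Complex.normSq (h i (σ y)) ≠ 0 := hpos _
  rw [h2, h3, angularForm_exp_mul (p := (y, t)) (g := fun i y ↦ h i (σ y)) s hσy hσx,
    hσ.proj_param hy t] at h1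
  refine h1.trans ?_
  ext v <;> simp [modelForm]

end Transfer

section Positivity

variable {n : ℕ} {B : Type*} [TopologicalSpace B]
  [ChartedSpace (EuclideanSpace ℝ (Fin (2 * n))) B] [IsManifold (𝓡 (2 * n)) ∞ B]

/-- The contact volume of the invariant form `u dθ + β` on the trivial bundle in the chart at
`b₀`. -/
def trivialVolume (α : OneForm ((𝓡 (2 * n)).prod (𝓡 1)) (B × Circle)) (b₀ : B)
    (y : EuclideanSpace ℝ (Fin (2 * n))) : ℝ :=
  frameVolume n (EuclideanSpace.basisFun (Fin (2 * n)) ℝ)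
    (modelForm (fun y ↦ unitSectionValue α ((extChartAt (𝓡 (2 * n)) b₀).symm y))
      (unitSectionForm α b₀) (y, 0))
    (fun v w ↦ dForm (modelForm (fun y ↦ unitSectionValue α ((extChartAt (𝓡 (2 * n)) b₀).symm y))
      (unitSectionForm α b₀)) (y, 0) v w)

variable {o : ManifoldOrientation (2 * n) B}

lemma trivialVolume_pos {α : OneForm ((𝓡 (2 * n)).prod (𝓡 1)) (B × Circle)}
    (hα : IsPositiveContactForm (trivialCircleBundle (𝓡 (2 * n)) B) o α)
    (hinv : ∀ (z : Circle) (x : B × Circle)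
      (v : EuclideanSpace ℝ (Fin (2 * n)) × EuclideanSpace ℝ (Fin 1)),
      (α.toFun x : EuclideanSpace ℝ (Fin (2 * n)) × EuclideanSpace ℝ (Fin 1) →L[ℝ] ℝ) v = 0 →
      (α.toFun ((trivialCircleBundle (𝓡 (2 * n)) B).act z x) :
        EuclideanSpace ℝ (Fin (2 * n)) × EuclideanSpace ℝ (Fin 1) →L[ℝ] ℝ)
        ((mfderiv ((𝓡 (2 * n)).prod (𝓡 1)) ((𝓡 (2 * n)).prod (𝓡 1))
          ((trivialCircleBundle (𝓡 (2 * n)) B).act z) x :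
          EuclideanSpace ℝ (Fin (2 * n)) × EuclideanSpace ℝ (Fin 1) →L[ℝ]
            EuclideanSpace ℝ (Fin (2 * n)) × EuclideanSpace ℝ (Fin 1)) v) = 0)
    (b₀ : B) {y : EuclideanSpace ℝ (Fin (2 * n))} (hy : y ∈ (extChartAt (𝓡 (2 * n)) b₀).target)
    (e : Module.Basis (Fin (2 * n)) ℝ (EuclideanSpace ℝ (Fin (2 * n))))
    (he : ∀ i, e i = (mfderiv 𝓘(ℝ, EuclideanSpace ℝ (Fin (2 * n))) (𝓡 (2 * n))
        (extChartAt (𝓡 (2 * n)) b₀).symm y : _ →L[ℝ] EuclideanSpace ℝ (Fin (2 * n)))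
          (EuclideanSpace.basisFun (Fin (2 * n)) ℝ i))
    {b : B} (hb : b = (extChartAt (𝓡 (2 * n)) b₀).symm y)
    (η : TangentSpace (𝓡 (2 * n)) b [⋀^Fin (2 * n)]→ₗ[ℝ] ℝ) (hη : η ≠ 0)
    (hray : rayOfNeZero ℝ η hη = o.orient b) :
    0 < η e * trivialVolume α b₀ y := by
  subst hb
  have hσ := trivialCircleBundle_isLocalSection (n := n) (B := B) b₀
  have hw : (fun i ↦ mfderiv ((𝓡 (2 * n)).prod (𝓡 1)) (𝓡 (2 * n))
      (trivialCircleBundle (𝓡 (2 * n)) B).proj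
      ((trivialCircleBundle (𝓡 (2 * n)) B).param
        (fun y ↦ ((extChartAt (𝓡 (2 * n)) b₀).symm y, (1 : Circle))) (y, 0))
      (PrincipalCircleBundle.IsLocalSection.frame (trivialCircleBundle (𝓡 (2 * n)) B)
        (fun y ↦ ((extChartAt (𝓡 (2 * n)) b₀).symm y, (1 : Circle))) (y, 0) i)) = e := by
    funext i
    rw [he]
    exact hσ.mfderiv_proj_mfderiv_param hy 0 _
  have hne : η e ≠ 0 := (AlternatingMap.map_basis_ne_zero_iff e η).2 hη
  have h1 := hα ((trivialCircleBundle (𝓡 (2 * n)) B).param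
    (fun y ↦ ((extChartAt (𝓡 (2 * n)) b₀).symm y, (1 : Circle))) (y, 0)) η hη hray
    (PrincipalCircleBundle.IsLocalSection.frame (trivialCircleBundle (𝓡 (2 * n)) B)
        (fun y ↦ ((extChartAt (𝓡 (2 * n)) b₀).symm y, (1 : Circle))) (y, 0))
    ((congrArg η hw).trans_ne hne)
  have h2 := hσ.contactVolume_invariant α hinv hy
  rw [h2] at h1
  rw [← congrArg η hw]
  exact h1

variable {E : Type*} [NormedAddCommGroup E] [NormedSpace ℝ E]
  {H : Type*} [TopologicalSpace H] {I : ModelWithCorners ℝ E H}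
  {M : Type*} [TopologicalSpace M] [ChartedSpace H M] [IsManifold I ∞ M] [I.Boundaryless]
  {P : PrincipalCircleBundle (𝓡 (2 * n)) B I M}
  {b₀ : B} {O : Set (EuclideanSpace ℝ (Fin (2 * n)))}
  {σ : EuclideanSpace ℝ (Fin (2 * n)) → M}

/-- The contact volumes on a frame and on arbitrary vectors are related through a volume form on
the base. -/
lemma contactVolume_mul_eq (hσ : P.IsLocalSection b₀ O σ) (α : OneForm I M)
    {y : EuclideanSpace ℝ (Fin (2 * n))} (hy : y ∈ O) {t : ℝ}
    (hsurj : Function.Surjective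
      (mfderiv 𝓘(ℝ, EuclideanSpace ℝ (Fin (2 * n)) × ℝ) I (P.param σ) (y, t) : _ →L[ℝ] E))
    (e : Module.Basis (Fin (2 * n)) ℝ (EuclideanSpace ℝ (Fin (2 * n))))
    (he : ∀ i, e i = (mfderiv 𝓘(ℝ, EuclideanSpace ℝ (Fin (2 * n))) (𝓡 (2 * n))
        (extChartAt (𝓡 (2 * n)) b₀).symm y : _ →L[ℝ] EuclideanSpace ℝ (Fin (2 * n)))
          (EuclideanSpace.basisFun (Fin (2 * n)) ℝ i))
    (η : TangentSpace (𝓡 (2 * n)) (P.proj (P.param σ (y, t))) [⋀^Fin (2 * n)]→ₗ[ℝ] ℝ)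
    (v : Fin (2 * n) → TangentSpace I (P.param σ (y, t))) :
    α.contactVolume n (P.param σ (y, t)) (Fin.cons (P.generator (P.param σ (y, t))) v) * η e =
      frameVolume n (EuclideanSpace.basisFun (Fin (2 * n)) ℝ)
        (pullbackCovector α.toFun (P.param σ) (y, t))
        (fun v w ↦ dForm (pullbackCovector α.toFun (P.param σ)) (y, t) v w) *
      η (fun i ↦ mfderiv I (𝓡 (2 * n)) P.proj (P.param σ (y, t)) (v i)) := by
  rw [← hσ.contactVolume_frame α hy t, ← OneForm.contactAlternating_apply,
    ← OneForm.contactAlternating_apply]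
  exact alternating_cons_mul_eq (α.contactAlternating n (P.param σ (y, t)))
    (P.generator (P.param σ (y, t)))
    (mfderiv I (𝓡 (2 * n)) P.proj (P.param σ (y, t)) :
      TangentSpace I (P.param σ (y, t)) →ₗ[ℝ] TangentSpace (𝓡 (2 * n)) (P.proj (P.param σ (y, t))))
    (hσ.exists_smul_generator hy hsurj) e
    (PrincipalCircleBundle.IsLocalSection.frame P σ (y, t))
    (fun i ↦ (hσ.mfderiv_proj_mfderiv_param hy t _).trans (he i).symm) η v

variable {α : OneForm ((𝓡 (2 * n)).prod (𝓡 1)) (B × Circle)}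
  {ι : Type*} {s : Finset ι} {h : ι → M → ℂ}

lemma mul_pos_of_relations {c A d W W₀ : ℝ} (hc : c ≠ 0) (h1 : A * d = W * c) (h2 : 0 < d * W₀)
    (h3 : 0 < W * W₀) : 0 < c * A := by
  have h4 : 0 < d * W := by
    have : 0 < (d * W) * W₀ ^ 2 := by
      calc (0 : ℝ) < (d * W₀) * (W * W₀) := mul_pos h2 h3
        _ = _ := by ring
    exact pos_of_mul_pos_left this (sq_nonneg _)
  have h5 : 0 < (c * A) * d ^ 2 := by
    calc (0 : ℝ) < (d * W) * c ^ 2 := by positivity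
      _ = (W * c) * (c * d) := by ring
      _ = (A * d) * (c * d) := by rw [h1]
      _ = _ := by ring
  exact pos_of_mul_pos_left h5 (sq_nonneg _)

lemma exists_transferForm_pos
    (hα : IsPositiveContactForm (trivialCircleBundle (𝓡 (2 * n)) B) o α)
    (hinv : ∀ (z : Circle) (x : B × Circle)
      (v : EuclideanSpace ℝ (Fin (2 * n)) × EuclideanSpace ℝ (Fin 1)),
      (α.toFun x : EuclideanSpace ℝ (Fin (2 * n)) × EuclideanSpace ℝ (Fin 1) →L[ℝ] ℝ) v = 0 →
      (α.toFun ((trivialCircleBundle (𝓡 (2 * n)) B).act z x) :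
        EuclideanSpace ℝ (Fin (2 * n)) × EuclideanSpace ℝ (Fin 1) →L[ℝ] ℝ)
        ((mfderiv ((𝓡 (2 * n)).prod (𝓡 1)) ((𝓡 (2 * n)).prod (𝓡 1))
          ((trivialCircleBundle (𝓡 (2 * n)) B).act z) x :
          EuclideanSpace ℝ (Fin (2 * n)) × EuclideanSpace ℝ (Fin 1) →L[ℝ]
            EuclideanSpace ℝ (Fin (2 * n)) × EuclideanSpace ℝ (Fin 1)) v) = 0)
    (hh : ∀ i, ContMDiff I 𝓘(ℝ, ℂ) ∞ (h i))
    (hpos : ∀ x, ∑ i ∈ s, Complex.normSq (h i x) ≠ 0)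
    (heq : ∀ i z x, h i (P.act z x) = z * h i x) (b₀ : B) :
    ∃ K₀ : ℝ, ∀ᶠ b in 𝓝 b₀, ∀ K ≥ K₀, ∀ x : M, P.proj x = b →
      ∀ (η : TangentSpace (𝓡 (2 * n)) (P.proj x) [⋀^Fin (2 * n)]→ₗ[ℝ] ℝ) (hη : η ≠ 0),
        rayOfNeZero ℝ η hη = o.orient (P.proj x) →
        ∀ v : Fin (2 * n) → TangentSpace I x,
          η (fun i ↦ mfderiv I (𝓡 (2 * n)) P.proj x (v i)) ≠ 0 →
          0 < η (fun i ↦ mfderiv I (𝓡 (2 * n)) P.proj x (v i)) *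
            (transferForm P α s h hh hpos K).contactVolume n x (Fin.cons (P.generator x) v) := by
  obtain ⟨O, σ, hσ, hsurj⟩ := P.exists_isLocalSection b₀
  have hσ₀ := trivialCircleBundle_isLocalSection (n := n) (B := B) b₀
  have hU : ∀ y ∈ O, ContDiffAt ℝ ∞
      (fun y ↦ unitSectionValue α ((extChartAt (𝓡 (2 * n)) b₀).symm y)) y := fun y hy ↦
    hσ₀.contDiffAt_generatorValue α (hσ.subset_target hy)
  have hβ : ∀ y ∈ O, ContDiffAt ℝ ∞ (unitSectionForm α b₀) y := fun y hy ↦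
    α.contDiffAt_pullback (hσ₀.smooth y (hσ.subset_target hy))
  have hc : ∀ y ∈ O, ContDiffAt ℝ ∞
      (fun y ↦ unitSectionValue α ((extChartAt (𝓡 (2 * n)) b₀).symm y) •
        angularForm s (fun i y ↦ h i (σ y)) y) y := fun y hy ↦
    (hU y hy).smul (contDiffAt_angularForm s
      (fun i ↦ ((hh i).contMDiffAt.comp y (hσ.smooth y hy)).contDiffAt) (hpos _))
  have hne : trivialVolume α b₀ (extChartAt (𝓡 (2 * n)) b₀ b₀) ≠ 0 := by
    obtain ⟨e, he⟩ := hσ.exists_basis hσ.mem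
    have := trivialVolume_pos hα hinv b₀ (hσ.subset_target hσ.mem) e he
      (extChartAt_to_inv (I := 𝓡 (2 * n)) b₀).symm (o.orient b₀).someVector
      (o.orient b₀).someVector_ne_zero (o.orient b₀).someVector_ray
    exact right_ne_zero_of_mul this.ne'
  obtain ⟨K₀, hK₀⟩ := exists_frameVolume_mul_pos n (EuclideanSpace.basisFun (Fin (2 * n)) ℝ)
    hσ.isOpen hσ.mem (fun y hy ↦ (hU y hy).of_le (by norm_cast))
    (fun y hy ↦ (hβ y hy).of_le (by norm_cast)) (fun y hy ↦ (hc y hy).of_le (by norm_cast)) hne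
  refine ⟨K₀, ?_⟩
  have hcont := (continuousAt_extChartAt (I := 𝓡 (2 * n)) b₀)
  filter_upwards [hcont.eventually hK₀, hcont (hσ.mem_nhds hσ.mem),
    extChartAt_source_mem_nhds (I := 𝓡 (2 * n)) b₀] with b hbK hbO hbs K hK x hxb
  set y := extChartAt (𝓡 (2 * n)) b₀ b
  have hy : y ∈ O := hbO
  have hby : b = (extChartAt (𝓡 (2 * n)) b₀).symm y := ((extChartAt (𝓡 (2 * n)) b₀).left_inv hbs).symm
  obtain ⟨z, hz⟩ := P.exists_act_eq (x := σ y) (x' := x) (by rw [hσ.proj_eq y hy, hxb, hby])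
  obtain ⟨t, rfl⟩ : ∃ t, x = P.param σ (y, t) :=
    ⟨Complex.arg z, by rw [PrincipalCircleBundle.param, Circle.exp_arg, hz]⟩
  intro η hη hray v hv
  obtain ⟨e, he⟩ := hσ.exists_basis hy
  have h1 := contactVolume_mul_eq hσ (transferForm P α s h hh hpos K) hy (hsurj y hy t) e he η v
  have h2 := trivialVolume_pos hα hinv b₀ (hσ.subset_target hy) e he (hxb.trans hby) η hη hray
  have h3 := hbK K hK t
  have hev : pullbackCovector (transferForm P α s h hh hpos K).toFun (P.param σ) =ᶠ[𝓝 (y, t)]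
      modelForm (fun y ↦ unitSectionValue α ((extChartAt (𝓡 (2 * n)) b₀).symm y))
        ((fun y ↦ unitSectionValue α ((extChartAt (𝓡 (2 * n)) b₀).symm y) •
          angularForm s (fun i y ↦ h i (σ y)) y) + K • unitSectionForm α b₀) := by
    filter_upwards [continuousAt_fst (p := (y, t)) (hσ.mem_nhds hy)] with p hp
    exact pullback_transferForm P α s h hh hpos K hσ heq hp p.2
  rw [dForm_congr hev, hev.self_of_nhds] at h1
  change 0 < _ * trivialVolume α b₀ y at h3
  exact mul_pos_of_relations hv h1 h2 h3

end Positivity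

section Existence

variable {n : ℕ} {B : Type*} [TopologicalSpace B]
  [ChartedSpace (EuclideanSpace ℝ (Fin (2 * n))) B] [IsManifold (𝓡 (2 * n)) ∞ B]
  {E : Type*} [NormedAddCommGroup E] [NormedSpace ℝ E]
  {H : Type*} [TopologicalSpace H] {I : ModelWithCorners ℝ E H}
  {M : Type*} [TopologicalSpace M] [ChartedSpace H M] [IsManifold I ∞ M] [I.Boundaryless]
  {P : PrincipalCircleBundle (𝓡 (2 * n)) B I M} {o : ManifoldOrientation (2 * n) B}
  {α : OneForm ((𝓡 (2 * n)).prod (𝓡 1)) (B × Circle)}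
  {ι : Type*} {s : Finset ι} {h : ι → M → ℂ}

lemma generatorValue_transferForm (hh : ∀ i, ContMDiff I 𝓘(ℝ, ℂ) ∞ (h i))
    (hpos : ∀ x, ∑ i ∈ s, Complex.normSq (h i x) ≠ 0)
    (heq : ∀ i z x, h i (P.act z x) = z * h i x) (K : ℝ) (x : M) :
    P.generatorValue (transferForm P α s h hh hpos K).toFun x = unitSectionValue α (P.proj x) := by
  obtain ⟨O, σ, hσ, -⟩ := P.exists_isLocalSection (P.proj x)
  set y := extChartAt (𝓡 (2 * n)) (P.proj x) (P.proj x)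
  have hy : (extChartAt (𝓡 (2 * n)) (P.proj x)).symm y = P.proj x := extChartAt_to_inv _
  obtain ⟨z, hz⟩ := P.exists_act_eq (x := σ y) (x' := x) (by rw [hσ.proj_eq y hσ.mem, hy])
  have hx : P.param σ (y, Complex.arg z) = x := by
    rw [PrincipalCircleBundle.param, Circle.exp_arg, hz]
  have h1 := DFunLike.congr_fun
    (pullback_transferForm P α s h hh hpos K hσ heq hσ.mem (Complex.arg z)) (0, 1)
  rw [modelForm_apply] at h1
  simp only [map_zero, mul_one, add_zero] at h1
  rw [hy] at h1
  have h2 : P.generatorValue (transferForm P α s h hh hpos K).toFun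
      (P.param σ (y, Complex.arg z)) = unitSectionValue α (P.proj x) :=
    (congrArg ((transferForm P α s h hh hpos K).toFun (P.param σ (y, Complex.arg z)) :
      E →L[ℝ] ℝ) (hσ.mfderiv_param_snd hσ.mem (Complex.arg z)).symm).trans h1
  rwa [hx] at h2

/-- The invariant contact structure defined by a positive contact form which is preserved by the
circle action. -/
def InvariantContactStructure.ofForm (α : OneForm I M) (hα : IsPositiveContactForm P o α)
    (hact : ∀ (z : Circle) (x : M) (v : E),
      (α.toFun (P.act z x) : E →L[ℝ] ℝ) ((mfderiv I I (P.act z) x : E →L[ℝ] E) v) =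
        (α.toFun x : E →L[ℝ] ℝ) v) : InvariantContactStructure P o where
  plane x := LinearMap.ker (α.toFun x : TangentSpace I x →ₗ[ℝ] ℝ)
  exists_form := ⟨α, hα, fun _ ↦ rfl⟩
  invariant z x := by
    refine le_antisymm ?_ fun w hw ↦ ?_
    · rintro _ ⟨v, hv, rfl⟩
      exact (hact z x v).trans hv
    · have hw' := P.mfderiv_act_act_inv z x w
      refine ⟨(mfderiv I I (P.act z⁻¹) (P.act z x) : E →L[ℝ] E) w, ?_, hw'⟩
      refine (hact z x _).symm.trans ?_
      exact (congrArg (α.toFun (P.act z x) : E →L[ℝ] ℝ) hw').trans hw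

lemma dividingSet_trivial_eq {ξ : InvariantContactStructure (trivialCircleBundle (𝓡 (2 * n)) B) o}
    (hα : ∀ x, ξ.plane x =
      LinearMap.ker (α.toFun x : TangentSpace ((𝓡 (2 * n)).prod (𝓡 1)) x →ₗ[ℝ] ℝ)) :
    ξ.dividingSet = {b | unitSectionValue α b = 0} := by
  have hmem : ∀ x, (trivialCircleBundle (𝓡 (2 * n)) B).generator x ∈ ξ.plane x ↔
      (trivialCircleBundle (𝓡 (2 * n)) B).generatorValue α.toFun x = 0 := by
    intro x
    rw [hα]
    exact Iff.rfl
  ext b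
  constructor
  · rintro ⟨⟨b', z⟩, rfl, hx⟩
    have h1 := generatorValue_act_eq_zero (ξ.form_act_eq_zero hα) z⁻¹ ((hmem _).1 hx)
    have h2 : (trivialCircleBundle (𝓡 (2 * n)) B).act z⁻¹ (b', z) = (b', 1) :=
      Prod.ext rfl (inv_mul_cancel z)
    rw [h2] at h1
    exact h1
  · intro hb
    exact ⟨(b, 1), rfl, (hmem _).2 hb⟩

end Existence

end CircleBundleContact

end

theorem mainTheorem3 {n : ℕ} {B : Type*} [TopologicalSpace B]
    [ChartedSpace (EuclideanSpace ℝ (Fin (2 * n))) B] [IsManifold (𝓡 (2 * n)) ∞ B]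
    [CompactSpace B] [T2Space B]
    (o : CircleBundleContact.ManifoldOrientation (2 * n) B) (Γ : Set B)
    (hΓ : ∃ ξ : CircleBundleContact.InvariantContactStructure
      (CircleBundleContact.trivialCircleBundle (𝓡 (2 * n)) B) o, ξ.dividingSet = Γ)
    {E : Type*} [NormedAddCommGroup E] [NormedSpace ℝ E] [FiniteDimensional ℝ E]
    {H : Type*} [TopologicalSpace H] {I : ModelWithCorners ℝ E H} [I.Boundaryless]
    {M : Type*} [TopologicalSpace M] [ChartedSpace H M] [IsManifold I ∞ M]
    (P : CircleBundleContact.PrincipalCircleBundle (𝓡 (2 * n)) B I M) :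
    ∃ ξ : CircleBundleContact.InvariantContactStructure P o, ξ.dividingSet = Γ := by
  obtain ⟨ξ₀, rfl⟩ := hΓ
  obtain ⟨α, hα, hker⟩ := ξ₀.exists_form
  obtain ⟨s, h, hh, heq, hs⟩ := P.exists_equivariant_family
  have hpos : ∀ x, ∑ i ∈ s, Complex.normSq (h i x) ≠ 0 := fun x ↦ (hs x).ne'
  choose K₀ hK₀ using CircleBundleContact.exists_transferForm_pos hα (ξ₀.form_act_eq_zero hker) hh
    hpos heq
  obtain ⟨t, ht⟩ := CompactSpace.elim_nhds_subcover _ hK₀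
  obtain ⟨K, hK⟩ := (t.image K₀).exists_le
  have hform : CircleBundleContact.IsPositiveContactForm P o
      (CircleBundleContact.transferForm P α s h hh hpos K) := by
    intro x
    have hx : P.proj x ∈ (⊤ : Set B) := trivial
    rw [← ht] at hx
    obtain ⟨i, hi, hix⟩ := Set.mem_iUnion₂.1 hx
    exact hix K (hK _ (Finset.mem_image_of_mem _ hi)) x rfl
  refine ⟨CircleBundleContact.InvariantContactStructure.ofForm _ hform
    (CircleBundleContact.transferForm_act P α s h hh hpos K heq), ?_⟩
  rw [CircleBundleContact.dividingSet_trivial_eq hker]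
  ext b
  have hval := CircleBundleContact.generatorValue_transferForm (α := α) hh hpos heq K
  constructor
  · rintro ⟨x, rfl, hx⟩
    exact (hval x).symm.trans hx
  · intro hb
    obtain ⟨x, rfl⟩ := P.exists_proj_eq b
    exact ⟨x, rfl, (hval x).trans hb⟩
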